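/- A metric valued field is a field $F$ with a multiplicative non-archimedean absolute value $|\cdot|:F\to\mathbb R_{\ge 0}$ (possibly trivial) for which $F$ is complete; its value group is the subgroup $\{|x| : x\in F^\times\}$ of the multiplicative group $\mathbb R^+$ of positive reals. Its projective line $F\mathbb P^1$ is regarded as a metric structure as follows: writing points as $\mathbf a=[a^\circ:a^*]$ with $\max(|a^\circ|,|a^*|)=1$, the metric is $d(\mathbf a,\mathbf b)=|a^\circ b^*-a^*b^\circ|$, there is a constant $\infty=[1:0]$, and for every $n$ and every $P\in\mathbb Z[X_1,\dots,X_n]$ there is a predicate $\|P(\mathbf a_1,\dots,\mathbf a_n)\|=|P^h(a^\circ,a^*)|\in[0,1]$, where $P^h(\bar X,\bar X^*)=P(X_1/X_1^*,\dots,X_n/X_n^*)\prod_i (X_i^*)^{\deg_{X_i}P}$. Let $(K_i)_{i\in I}$ be a family of metric valued fields with value groups $\Gamma_i\subseteq\mathbb R^+$, and let $\mathcal D$ be any ultrafilter on $I$. Metric side. Let $M$ be the metric ultraproduct of the structures $K_i\mathbb P^1$ along $\mathcal D$: the quotient of $\prod_i K_i\mathbb P^1$ by $\lim_{\mathcal D}d(x_i,y_i)=0$,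 with metric $\lim_{\mathcal D}d(x_i,y_i)$, constant the class of $(\infty)_i$, and predicates $\lim_{\mathcal D}\|P(x_i)\|$. An underlying metric valued field of $M$ is a metric valued field $K^{me}$ such that $K^{me}\mathbb P^1$ and $M$ are isomorphic (by a bijection preserving the metric, the constant and all predicates). Classical side. Let $K$ and $\Gamma$ be the classical ultraproducts of the fields $K_i$ and of the ordered groups $\Gamma_i$, and $v:K\to\Gamma\cup\{0\}$ the ultraproduct valuation. Regard $\Gamma$ as an ordered subgroup of the classical ultrapower $(\mathbb R^+)_{\mathcal D}$, in which $\mathbb R^+$ is embedded diagonally. Let $\Gamma_{fin}$ be the intersection of $\Gamma$ with the convex hull of $\mathbb R^+$, and $\Gamma_{inf}$ its intersection with the largest convex subgroup meeting $\mathbb R^+$ only in $1$. Let $\bar v:K\to\Gamma/\Gamma_{fin}\cup\{0\}$ be the coarsening of $v$, $\bar K$ the residue field of $\bar v$, $v_{fin}:\bar K\to\Gamma_{fin}\cup\{0\}$ the valuation induced by $v$, $\bar\Gamma=\Gamma_{fin}/\Gamma_{inf}$, and $\bar v_{fin}:\bar K\to\bar\Gamma\cup\{0\}$ the coarsening of $v_{fin}$.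 Let $\bar\alpha:\bar\Gamma\hookrightarrow\mathbb R^+$ be the embedding of ordered groups induced by the standard part map $\Gamma_{fin}\to\mathbb R^+$, extended by $\bar\alpha(0)=0$. Theorem. $M$ has an underlying metric valued field, and for every underlying metric valued field $(K^{me},|\cdot|)$ of $M$ there is an isomorphism of valued fields $f:(\bar K,\bar v_{fin})\to(K^{me},|\cdot|)$ that induces the identity on $\bar\alpha(\bar\Gamma)$. That is, $f$ is a field isomorphism such that $\bar v_{fin}(x)\le\bar v_{fin}(y)\iff|f(x)|\le|f(y)|$ for all $x,y\in\bar K$; $|f(x)|=\bar\alpha(\bar v_{fin}(x))$ for all $x\in\bar K$; and the value group of $K^{me}$ is $\bar\alpha(\bar\Gamma)$. -/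

import Mathlib

open Filter Topology

/-! ### Classical ultraproducts -/

/-- The classical ultraproduct of the sets `A i` along `D`: the quotient of the full product by
equality on a set of indices in `D`. -/
abbrev UProd {ι : Type*} (D : Ultrafilter ι) (A : ι → Type*) : Type _ :=
  (D : Filter ι).Product A

namespace UProd

variable {ι : Type*} {D : Ultrafilter ι} {A B : ι → Type*}

/-- The class of a family. -/
def mk (D : Ultrafilter ι) (x : ∀ i, A i) : UProd D A :=
  Quotient.mk ((D : Filter ι).productSetoid A) x

theorem mk_surj (z : UProd D A) : ∃ x, mk D x = z := Quotient.exists_rep z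

theorem mk_eq {x y : ∀ i, A i} : mk D x = mk D y ↔ ∀ᶠ i in (D : Filter ι), x i = y i :=
  Quotient.eq (r := (D : Filter ι).productSetoid A)

/-- The map of ultraproducts given by a family of maps. -/
def map (f : ∀ i, A i → B i) : UProd D A → UProd D B :=
  Quotient.map' (s₁ := (D : Filter ι).productSetoid A) (s₂ := (D : Filter ι).productSetoid B)
    (fun x i => f i (x i)) (fun _ _ h => Eventually.mono h fun _ hi => congrArg _ hi)

@[simp] theorem map_mk (f : ∀ i, A i → B i) (x : ∀ i, A i) :
    map f (mk D x) = mk D fun i => f i (x i) := rfl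

instance [∀ i, Zero (A i)] : Zero (UProd D A) := ⟨mk D fun _ => 0⟩
instance [∀ i, One (A i)] : One (UProd D A) := ⟨mk D fun _ => 1⟩
instance [∀ i, Neg (A i)] : Neg (UProd D A) := ⟨map fun _ a => -a⟩
instance [∀ i, Inv (A i)] : Inv (UProd D A) := ⟨map fun _ a => a⁻¹⟩
instance [∀ i, Add (A i)] : Add (UProd D A) :=
  ⟨Quotient.map₂ (sa := (D : Filter ι).productSetoid A) (sb := (D : Filter ι).productSetoid A)
    (sc := (D : Filter ι).productSetoid A) (fun x y i => x i + y i)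
    (fun _ _ h _ _ h' => by
      filter_upwards [h, h'] with i hi hi'
      rw [hi, hi'])⟩
instance [∀ i, Mul (A i)] : Mul (UProd D A) :=
  ⟨Quotient.map₂ (sa := (D : Filter ι).productSetoid A) (sb := (D : Filter ι).productSetoid A)
    (sc := (D : Filter ι).productSetoid A) (fun x y i => x i * y i)
    (fun _ _ h _ _ h' => by
      filter_upwards [h, h'] with i hi hi'
      rw [hi, hi'])⟩

theorem zero_def [∀ i, Zero (A i)] : (0 : UProd D A) = mk D fun _ => 0 := rfl
theorem one_def [∀ i, One (A i)] : (1 : UProd D A) = mk D fun _ => 1 := rfl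
theorem mk_add [∀ i, Add (A i)] (x y : ∀ i, A i) :
    mk D x + mk D y = mk D fun i => x i + y i := rfl
theorem mk_mul [∀ i, Mul (A i)] (x y : ∀ i, A i) :
    mk D x * mk D y = mk D fun i => x i * y i := rfl
theorem mk_neg [∀ i, Neg (A i)] (x : ∀ i, A i) : -mk D x = mk D fun i => -x i := rfl
theorem mk_inv [∀ i, Inv (A i)] (x : ∀ i, A i) : (mk D x)⁻¹ = mk D fun i => (x i)⁻¹ := rfl

theorem ind {p : UProd D A → Prop} (h : ∀ x, p (mk D x)) (z : UProd D A) : p z :=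
  Quotient.ind h z

instance [∀ i, CommGroup (A i)] : CommGroup (UProd D A) where
  mul_assoc := ind fun x => ind fun y => ind fun z => by simp only [mk_mul, mul_assoc]
  one_mul := ind fun x => by simp only [one_def, mk_mul, one_mul]
  mul_one := ind fun x => by simp only [one_def, mk_mul, mul_one]
  inv_mul_cancel := ind fun x => by simp only [one_def, mk_mul, mk_inv, inv_mul_cancel]
  mul_comm := ind fun x => ind fun y => by simp only [mk_mul, mul_comm]

instance [∀ i, CommRing (A i)] : CommRing (UProd D A) where
  add_assoc := ind fun x => ind fun y => ind fun z => by simp only [mk_add, add_assoc]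
  zero_add := ind fun x => by simp only [zero_def, mk_add, zero_add]
  add_zero := ind fun x => by simp only [zero_def, mk_add, add_zero]
  add_comm := ind fun x => ind fun y => by simp only [mk_add, add_comm]
  neg_add_cancel := ind fun x => by simp only [zero_def, mk_add, mk_neg, neg_add_cancel]
  mul_assoc := ind fun x => ind fun y => ind fun z => by simp only [mk_mul, mul_assoc]
  one_mul := ind fun x => by simp only [one_def, mk_mul, one_mul]
  mul_one := ind fun x => by simp only [one_def, mk_mul, mul_one]
  mul_comm := ind fun x => ind fun y => by simp only [mk_mul, mul_comm]
  left_distrib := ind fun x => ind fun y => ind fun z => by simp only [mk_mul, mk_add, mul_add]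
  right_distrib := ind fun x => ind fun y => ind fun z => by simp only [mk_mul, mk_add, add_mul]
  zero_mul := ind fun x => by simp only [zero_def, mk_mul, zero_mul]
  mul_zero := ind fun x => by simp only [zero_def, mk_mul, mul_zero]
  nsmul := nsmulRec
  zsmul := zsmulRec

noncomputable instance [∀ i, Field (A i)] : Field (UProd D A) where
  exists_pair_ne := ⟨0, 1, fun h => by
    rw [zero_def, one_def, mk_eq] at h
    obtain ⟨i, hi⟩ := h.exists
    exact zero_ne_one hi⟩
  mul_inv_cancel := ind fun x hx => by
    rw [zero_def, Ne, mk_eq, ← Ultrafilter.eventually_not] at hx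
    rw [one_def, mk_inv, mk_mul, mk_eq]
    filter_upwards [hx] with i hi
    exact mul_inv_cancel₀ hi
  inv_zero := by simp only [zero_def, mk_inv, inv_zero]
  nnqsmul := _
  nnqsmul_def := fun _ _ => rfl
  qsmul := _
  qsmul_def := fun _ _ => rfl

instance [∀ i, LE (A i)] : LE (UProd D A) :=
  ⟨Quotient.lift₂ (s₁ := (D : Filter ι).productSetoid A) (s₂ := (D : Filter ι).productSetoid A)
    (fun x y => ∀ᶠ i in (D : Filter ι), x i ≤ y i)
    (fun _ _ _ _ h h' => propext (eventually_congr (by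
      filter_upwards [h, h'] with i hi hi'
      rw [hi, hi'])))⟩

theorem mk_le [∀ i, LE (A i)] {x y : ∀ i, A i} :
    mk D x ≤ mk D y ↔ ∀ᶠ i in (D : Filter ι), x i ≤ y i := Iff.rfl

open scoped Classical in
noncomputable instance [∀ i, LinearOrder (A i)] : LinearOrder (UProd D A) where
  le_refl := ind fun x => by simp [mk_le]
  le_trans := ind fun x => ind fun y => ind fun z => by
    intro h h'
    rw [mk_le] at *
    filter_upwards [h, h'] with i hi hi'
    exact hi.trans hi'
  le_antisymm := ind fun x => ind fun y => by
    intro h h'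
    rw [mk_le] at h h'
    rw [mk_eq]
    filter_upwards [h, h'] with i hi hi'
    exact le_antisymm hi hi'
  le_total := ind fun x => ind fun y => by
    rw [mk_le, mk_le, ← Ultrafilter.eventually_or]
    exact Eventually.of_forall fun i => le_total _ _
  toDecidableLE := Classical.decRel _

instance [∀ i, CommGroup (A i)] [∀ i, LinearOrder (A i)] [∀ i, IsOrderedMonoid (A i)] :
    IsOrderedMonoid (UProd D A) where
  mul_le_mul_left := ind fun x => ind fun y h => ind fun z => by
    simp only [mk_mul, mk_le] at h ⊢
    filter_upwards [h] with i hi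
    exact mul_le_mul_left hi _

/-- The homomorphism of ultraproducts given by a family of homomorphisms. -/
def mapHom [∀ i, CommGroup (A i)] [∀ i, CommGroup (B i)] (f : ∀ i, A i →* B i) :
    UProd D A →* UProd D B where
  toFun := map fun i => f i
  map_one' := by simp only [one_def, map_mk, map_one]
  map_mul' := ind fun x => ind fun y => by simp only [mk_mul, map_mk, map_mul]

/-- The diagonal embedding of a group into its ultrapower. -/
def diag (D : Ultrafilter ι) (G : Type*) [CommGroup G] : G →* UProd D (fun _ => G) where
  toFun g := mk D fun _ => g
  map_one' := rfl
  map_mul' _ _ := rfl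

end UProd

/-! ### Quotients of ordered abelian groups and coarsenings of valuations -/

section Cut

variable {Γ : Type*} [CommGroup Γ]

open scoped Classical in
/-- The map `Γ ∪ {0} → Δ ∪ {0}` that fixes `Δ` and sends everything else to `0`. -/
noncomputable def cutToSubgroup (Δ : Subgroup Γ) : WithZero Γ → WithZero Δ :=
  WithZero.recZeroCoe 0 fun g => if h : g ∈ Δ then ((⟨g, h⟩ : Δ) : WithZero Δ) else 0

theorem cutToSubgroup_zero (Δ : Subgroup Γ) : cutToSubgroup Δ 0 = 0 := rfl

theorem cutToSubgroup_mem {Δ : Subgroup Γ} {g : Γ} (h : g ∈ Δ) :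
    cutToSubgroup Δ (g : WithZero Γ) = ((⟨g, h⟩ : Δ) : WithZero Δ) := dif_pos h

theorem cutToSubgroup_notMem {Δ : Subgroup Γ} {g : Γ} (h : g ∉ Δ) :
    cutToSubgroup Δ (g : WithZero Γ) = 0 := dif_neg h

end Cut

section Coarsening

variable {Γ : Type*} [CommGroup Γ] [LinearOrder Γ] [IsOrderedMonoid Γ]

/-- The order on the quotient of an ordered abelian group by a (convex) subgroup:
`aΔ ≤ bΔ` iff `a ≤ b * d` for some `d ∈ Δ`. -/
instance quotientLE (Δ : Subgroup Γ) : LE (Γ ⧸ Δ) where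
  le a b := ∃ x y : Γ, (x : Γ ⧸ Δ) = a ∧ (y : Γ ⧸ Δ) = b ∧ x ≤ y

theorem quotient_mk_le {Δ : Subgroup Γ} {a b : Γ} :
    (a : Γ ⧸ Δ) ≤ (b : Γ ⧸ Δ) ↔ ∃ d ∈ Δ, a ≤ b * d := by
  constructor
  · rintro ⟨x, y, hx, hy, h⟩
    rw [QuotientGroup.eq] at hx hy
    refine ⟨(y⁻¹ * b)⁻¹ * (x⁻¹ * a), Δ.mul_mem (Δ.inv_mem hy) hx, ?_⟩
    have : b * ((y⁻¹ * b)⁻¹ * (x⁻¹ * a)) = (y * x⁻¹) * a := by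
      simp only [mul_inv_rev, inv_inv]
      rw [← mul_assoc, ← mul_assoc, mul_inv_cancel_left]
    rw [this]
    exact le_mul_of_one_le_left' (by simpa using h)
  · rintro ⟨d, hd, h⟩
    exact ⟨a, b * d, rfl, by rw [QuotientGroup.eq]; simpa using hd, h⟩

open scoped Classical in
noncomputable instance quotientLinearOrder (Δ : Subgroup Γ) [hΔ : (Δ : Set Γ).OrdConnected] :
    LinearOrder (Γ ⧸ Δ) where
  le_refl a := by
    induction a using QuotientGroup.induction_on with
    | H a => exact ⟨a, a, rfl, rfl, le_rfl⟩
  le_trans a b c := by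
    induction a using QuotientGroup.induction_on with
    | H a =>
    induction b using QuotientGroup.induction_on with
    | H b =>
    induction c using QuotientGroup.induction_on with
    | H c =>
    simp only [quotient_mk_le]
    rintro ⟨d, hd, h⟩ ⟨e, he, h'⟩
    refine ⟨e * d, Δ.mul_mem he hd, h.trans ?_⟩
    rw [← mul_assoc]
    exact mul_le_mul_left h' _
  le_antisymm a b := by
    induction a using QuotientGroup.induction_on with
    | H a =>
    induction b using QuotientGroup.induction_on with
    | H b =>
    simp only [quotient_mk_le]
    rintro ⟨d, hd, h⟩ ⟨e, he, h'⟩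
    rw [QuotientGroup.eq]
    refine hΔ.out (Δ.inv_mem hd) he ⟨?_, ?_⟩
    · rw [inv_le_iff_one_le_mul', ← mul_assoc, mul_comm d, mul_assoc, ← div_eq_inv_mul,
        one_le_div', mul_comm]
      exact h
    · rw [inv_mul_le_iff_le_mul]
      exact h'
  le_total a b := by
    induction a using QuotientGroup.induction_on with
    | H a =>
    induction b using QuotientGroup.induction_on with
    | H b =>
    rcases le_total a b with h | h
    · exact Or.inl ⟨a, b, rfl, rfl, h⟩
    · exact Or.inr ⟨b, a, rfl, rfl, h⟩
  toDecidableLE := Classical.decRel _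

instance (Δ : Subgroup Γ) [(Δ : Set Γ).OrdConnected] : IsOrderedMonoid (Γ ⧸ Δ) where
  mul_le_mul_left a b h c := by
    induction a using QuotientGroup.induction_on with
    | H a =>
    induction b using QuotientGroup.induction_on with
    | H b =>
    induction c using QuotientGroup.induction_on with
    | H c =>
    obtain ⟨d, hd, h⟩ := quotient_mk_le.1 h
    rw [← QuotientGroup.mk_mul, ← QuotientGroup.mk_mul]
    refine quotient_mk_le.2 ⟨d, hd, ?_⟩
    rw [mul_right_comm]
    exact mul_le_mul_left h _

theorem quotient_mk_mono (Δ : Subgroup Γ) [(Δ : Set Γ).OrdConnected] :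
    Monotone (QuotientGroup.mk' Δ) := fun a b h => ⟨a, b, rfl, rfl, h⟩

variable {K : Type*} [Field K] (v : Valuation K (WithZero Γ))

/-- The coarsening `K → Γ/Δ ∪ {0}` of `v : K → Γ ∪ {0}` by the convex subgroup `Δ`. -/
noncomputable def coarsening (Δ : Subgroup Γ) [(Δ : Set Γ).OrdConnected] :
    Valuation K (WithZero (Γ ⧸ Δ)) :=
  v.map (WithZero.map' (QuotientGroup.mk' Δ)) (WithZero.map'_mono (quotient_mk_mono Δ))

/-- The residue field of the coarsening of `v` by `Δ`. -/
abbrev CoarseResidueField (Δ : Subgroup Γ) [(Δ : Set Γ).OrdConnected] : Type _ :=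
  IsLocalRing.ResidueField (coarsening v Δ).valuationSubring

variable (Δ : Subgroup Γ) [hΔ : (Δ : Set Γ).OrdConnected]

theorem coarsening_coe {x : K} {g : Γ} (h : v x = g) :
    coarsening v Δ x = ((g : Γ ⧸ Δ) : WithZero (Γ ⧸ Δ)) := by
  rw [coarsening, Valuation.map_apply, h]
  rfl

theorem mem_of_coarsening {x y : K} (hy : coarsening v Δ y ≤ 1) (h : v x ≤ v y) {g k : Γ}
    (hx : v x = g) (hk : v y = k) (hg : g ∈ Δ) : k ∈ Δ := by
  rw [hx, hk, WithZero.coe_le_coe] at h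
  rw [coarsening_coe v Δ hk, ← WithZero.coe_one, WithZero.coe_le_coe, ← QuotientGroup.mk_one,
    quotient_mk_le] at hy
  obtain ⟨d, hd, hkd⟩ := hy
  rw [one_mul] at hkd
  exact hΔ.out hg hd ⟨h, hkd⟩

/-- On the valuation ring of the coarsening, the part of `v` with values in `Δ ∪ {0}`. -/
noncomputable def cutValuation : Valuation (coarsening v Δ).valuationSubring (WithZero Δ) where
  toFun x := cutToSubgroup Δ (v x)
  map_zero' := by simp [cutToSubgroup_zero]
  map_one' := by
    have : v ((1 : (coarsening v Δ).valuationSubring) : K) = ((1 : Γ) : WithZero Γ) := by simp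
    rw [this, cutToSubgroup_mem Δ.one_mem]
    rfl
  map_mul' x y := by
    rcases eq_or_ne (v x) 0 with hx | hx
    · simp [hx, cutToSubgroup_zero]
    rcases eq_or_ne (v y) 0 with hy | hy
    · simp [hy, cutToSubgroup_zero]
    obtain ⟨g, hg⟩ := WithZero.ne_zero_iff_exists.1 hx
    obtain ⟨k, hk⟩ := WithZero.ne_zero_iff_exists.1 hy
    have hxy : v ((x * y : (coarsening v Δ).valuationSubring) : K) = ((g * k : Γ) : WithZero Γ) := by
      simp [hg, hk]
    have key : ∀ {a b : Γ} {z w : (coarsening v Δ).valuationSubring}, v z = a → v w = b →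
        a * b ∈ Δ → a ∈ Δ := by
      intro a b z w ha hb hab
      have hz := (Valuation.mem_valuationSubring_iff _ _).1 z.2
      have hw := (Valuation.mem_valuationSubring_iff _ _).1 w.2
      rw [coarsening_coe v Δ ha, ← WithZero.coe_one, WithZero.coe_le_coe] at hz
      rw [coarsening_coe v Δ hb, ← WithZero.coe_one, WithZero.coe_le_coe] at hw
      rw [← QuotientGroup.eq_one_iff] at hab ⊢
      rw [QuotientGroup.mk_mul] at hab
      exact le_antisymm hz (hab ▸ mul_le_of_le_one_right' hw)
    change cutToSubgroup Δ (v ((x * y : (coarsening v Δ).valuationSubring) : K)) =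
      cutToSubgroup Δ (v x) * cutToSubgroup Δ (v y)
    rw [hxy, ← hg, ← hk]
    by_cases hgΔ : g ∈ Δ
    · by_cases hkΔ : k ∈ Δ
      · rw [cutToSubgroup_mem hgΔ, cutToSubgroup_mem hkΔ, cutToSubgroup_mem (Δ.mul_mem hgΔ hkΔ)]
        rfl
      · rw [cutToSubgroup_notMem hkΔ, mul_zero, cutToSubgroup_notMem]
        exact fun h => hkΔ (key hk.symm hg.symm (mul_comm g k ▸ h))
    · rw [cutToSubgroup_notMem hgΔ, zero_mul, cutToSubgroup_notMem]
      exact fun h => hgΔ (key hg.symm hk.symm h)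
  map_add_le_max' x y := by
    have key : ∀ {z w : (coarsening v Δ).valuationSubring}, v z ≤ v w →
        cutToSubgroup Δ (v z) ≤ cutToSubgroup Δ (v w) := by
      intro z w h
      rcases eq_or_ne (v z) 0 with hz | hz
      · simp [hz, cutToSubgroup_zero]
      obtain ⟨g, hg⟩ := WithZero.ne_zero_iff_exists.1 hz
      by_cases hgΔ : g ∈ Δ
      · have hw : v w ≠ 0 := fun h0 => hz (le_zero_iff.1 (h0 ▸ h))
        obtain ⟨k, hk⟩ := WithZero.ne_zero_iff_exists.1 hw
        have hkΔ := mem_of_coarsening v Δ w.2 h hg.symm hk.symm hgΔ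
        rw [← hg, ← hk, cutToSubgroup_mem hgΔ, cutToSubgroup_mem hkΔ, WithZero.coe_le_coe]
        rw [← hg, ← hk, WithZero.coe_le_coe] at h
        exact h
      · rw [← hg, cutToSubgroup_notMem hgΔ]
        exact zero_le
    rcases le_total (v x) (v y) with h | h
    · exact (key (w := y) ((v.map_add _ _).trans (max_le h le_rfl))).trans (le_max_right _ _)
    · exact (key (w := x) ((v.map_add _ _).trans (max_le le_rfl h))).trans (le_max_left _ _)

theorem maximalIdeal_le_supp :
    IsLocalRing.maximalIdeal (coarsening v Δ).valuationSubring ≤ (cutValuation v Δ).supp := by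
  intro x hx
  rw [Valuation.mem_maximalIdeal_iff] at hx
  rw [Valuation.mem_supp_iff]
  change cutToSubgroup Δ (v x) = 0
  rcases eq_or_ne (v x) 0 with h | h
  · rw [h, cutToSubgroup_zero]
  obtain ⟨g, hg⟩ := WithZero.ne_zero_iff_exists.1 h
  rw [← hg]
  refine cutToSubgroup_notMem fun hgΔ => hx.ne ?_
  rw [coarsening_coe v Δ hg.symm, (QuotientGroup.eq_one_iff g).2 hgΔ, WithZero.coe_one]

/-- The valuation `res(x) ↦ v(x)` with values in `Δ ∪ {0}` which `v` induces on the residue field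
of its coarsening by `Δ`. -/
noncomputable def inducedValuation : Valuation (CoarseResidueField v Δ) (WithZero Δ) :=
  (cutValuation v Δ).onQuot (maximalIdeal_le_supp v Δ)

end Coarsening

/-! ### The classical ultraproduct of a family of metric valued fields -/

/-- The ordered multiplicative group of positive real numbers. -/
abbrev PosReal : Type := {r : ℝ // 0 < r}

section ValueGroup

variable (K : Type*) [NormedField K]

/-- The norm as a homomorphism from the units to the positive reals. -/
noncomputable def unitNormHom : Kˣ →* PosReal where
  toFun x := ⟨‖(x : K)‖, norm_pos_iff.2 x.ne_zero⟩
  map_one' := Subtype.ext (by simp)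
  map_mul' x y := Subtype.ext (by simp)

/-- The value group of a metric valued field, as a subgroup of the positive reals. -/
noncomputable def valueGroup : Subgroup PosReal := (unitNormHom K).range

variable {K}

open scoped Classical in
/-- The value of `x ≠ 0` in the value group (with junk value `1` at `x = 0`). -/
noncomputable def valueOf (x : K) : valueGroup K :=
  if h : x = 0 then 1 else ⟨unitNormHom K (Units.mk0 x h), ⟨_, rfl⟩⟩

theorem valueOf_coe {x : K} (h : x ≠ 0) : ((valueOf x : PosReal) : ℝ) = ‖x‖ := by
  rw [valueOf, dif_neg h]
  rfl

end ValueGroup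

section UltraValuation

variable {ι : Type*} (D : Ultrafilter ι) (K : ι → Type*) [∀ i, NormedField (K i)]

/-- The classical ultraproduct `Γ` of the value groups. -/
abbrev UValueGroup : Type _ := UProd D fun i => valueGroup (K i)

theorem UProd.eventually_ne_zero {x : ∀ i, K i} (h : UProd.mk D x ≠ 0) :
    ∀ᶠ i in (D : Filter ι), x i ≠ 0 := by
  rw [UProd.zero_def, Ne, UProd.mk_eq, ← Ultrafilter.eventually_not] at h
  exact h

open scoped Classical in
/-- The valuation `v : K → Γ ∪ {0}` on the classical ultraproduct `K` of the fields `K i`; it sends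
the class of a family `x` of (almost everywhere) nonzero elements to the class of the family of the
values `|x i|`. -/
noncomputable def ultraValuation [∀ i, IsUltrametricDist (K i)] :
    Valuation (UProd D K) (WithZero (UValueGroup D K)) where
  toFun z := if z = 0 then 0 else ((UProd.map (fun _ x => valueOf x) z : UValueGroup D K) :
    WithZero (UValueGroup D K))
  map_zero' := if_pos rfl
  map_one' := by
    rw [if_neg one_ne_zero, ← WithZero.coe_one, WithZero.coe_inj, UProd.one_def, UProd.map_mk,
      UProd.one_def, UProd.mk_eq]
    refine Eventually.of_forall fun i => Subtype.ext (Subtype.ext ?_)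
    rw [valueOf_coe one_ne_zero]
    simp
  map_mul' := UProd.ind fun x => UProd.ind fun y => by
    by_cases hx : UProd.mk D x = 0
    · simp [hx]
    by_cases hy : UProd.mk D y = 0
    · simp [hy]
    rw [if_neg hx, if_neg hy, if_neg (mul_ne_zero hx hy), ← WithZero.coe_mul, WithZero.coe_inj,
      UProd.mk_mul, UProd.map_mk, UProd.map_mk, UProd.map_mk, UProd.mk_mul, UProd.mk_eq]
    filter_upwards [UProd.eventually_ne_zero D K hx, UProd.eventually_ne_zero D K hy] with i h h'
    refine Subtype.ext (Subtype.ext ?_)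
    rw [valueOf_coe (mul_ne_zero h h')]
    simp [valueOf_coe h, valueOf_coe h']
  map_add_le_max' := UProd.ind fun x => UProd.ind fun y => by
    by_cases hx : UProd.mk D x = 0
    · simp [hx]
    by_cases hy : UProd.mk D y = 0
    · simp [hy]
    by_cases hxy : UProd.mk D x + UProd.mk D y = 0
    · simp [hxy]
    rw [if_neg hx, if_neg hy, if_neg hxy, UProd.mk_add, UProd.map_mk, UProd.map_mk, UProd.map_mk,
      le_max_iff, WithZero.coe_le_coe, WithZero.coe_le_coe, UProd.mk_le, UProd.mk_le,
      ← Ultrafilter.eventually_or]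
    filter_upwards [UProd.eventually_ne_zero D K hx, UProd.eventually_ne_zero D K hy,
      UProd.eventually_ne_zero D K hxy] with i h h' h''
    simp only [← Subtype.coe_le_coe]
    rw [valueOf_coe h, valueOf_coe h', valueOf_coe h'', ← le_max_iff]
    exact IsUltrametricDist.norm_add_le_max _ _

/-- The canonical embedding of `Γ` into the classical ultrapower of the positive reals. -/
noncomputable def valueEmbedding : UValueGroup D K →* UProd D fun _ => PosReal :=
  UProd.mapHom fun i => (valueGroup (K i)).subtype

theorem valueEmbedding_mono : Monotone (valueEmbedding D K) :=
  fun a b => UProd.ind (p := fun a => a ≤ b → valueEmbedding D K a ≤ valueEmbedding D K b)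
    (fun _ => UProd.ind (p := fun b => _ ≤ b → _ ≤ valueEmbedding D K b) (fun _ h => h) b) a

theorem UProd.diag_le {r s : PosReal} : UProd.diag D PosReal r ≤ UProd.diag D PosReal s ↔ r ≤ s :=
  eventually_const

/-- The infinitesimal elements of the ultrapower of the positive reals. -/
def infinitesimals : Subgroup (UProd D fun _ => PosReal) where
  carrier := {g | ∀ s : PosReal, 1 < s →
    UProd.diag D PosReal s⁻¹ ≤ g ∧ g ≤ UProd.diag D PosReal s}
  one_mem' s hs := by
    rw [← map_one (UProd.diag D PosReal), UProd.diag_le, UProd.diag_le]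
    exact ⟨inv_le_one'.2 hs.le, hs.le⟩
  mul_mem' {a b} ha hb s hs := by
    have hs' : (1 : ℝ) < s := hs
    let t : PosReal := ⟨√s, Real.sqrt_pos.2 s.2⟩
    have ht : 1 < t := by
      change (1 : ℝ) < √s
      rwa [Real.lt_sqrt zero_le_one, one_pow]
    have hst : s = t * t := Subtype.ext (Real.mul_self_sqrt s.2.le).symm
    rw [hst, mul_inv, map_mul, map_mul]
    exact ⟨mul_le_mul' (ha t ht).1 (hb t ht).1, mul_le_mul' (ha t ht).2 (hb t ht).2⟩
  inv_mem' {a} ha s hs := by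
    rw [map_inv, inv_le_inv_iff, inv_le', ← map_inv]
    exact ⟨(ha s hs).2, (ha s hs).1⟩

/-- The finite elements of the ultrapower of the positive reals: the convex hull of the diagonal. -/
def finites : Subgroup (UProd D fun _ => PosReal) where
  carrier := {g | ∃ r s : PosReal, UProd.diag D PosReal r ≤ g ∧ g ≤ UProd.diag D PosReal s}
  one_mem' := ⟨1, 1, (map_one (UProd.diag D PosReal)).le, (map_one (UProd.diag D PosReal)).ge⟩
  mul_mem' := by
    rintro a b ⟨r, s, h, h'⟩ ⟨r₁, s₁, h₁, h₁'⟩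
    refine ⟨r * r₁, s * s₁, ?_, ?_⟩
    · rw [map_mul]
      exact mul_le_mul' h h₁
    · rw [map_mul]
      exact mul_le_mul' h' h₁'
  inv_mem' := by
    rintro a ⟨r, s, h, h'⟩
    refine ⟨s⁻¹, r⁻¹, ?_, ?_⟩
    · rw [map_inv, inv_le_inv_iff]
      exact h'
    · rw [map_inv, inv_le_inv_iff]
      exact h

instance : (infinitesimals D : Set (UProd D fun _ => PosReal)).OrdConnected :=
  ⟨fun _ ha _ hb _ hc s hs => ⟨(ha s hs).1.trans hc.1, hc.2.trans (hb s hs).2⟩⟩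

instance : (finites D : Set (UProd D fun _ => PosReal)).OrdConnected :=
  ⟨fun _ ⟨r, _, hr, _⟩ _ ⟨_, s, _, hs⟩ _ hc => ⟨r, s, hr.trans hc.1, hc.2.trans hs⟩⟩

theorem diag_mem_infinitesimals {r : PosReal} (h : UProd.diag D PosReal r ∈ infinitesimals D) :
    r = 1 := by
  rcases lt_trichotomy r 1 with hr | hr | hr
  · have h2 : 1 < r⁻¹ := one_lt_inv'.2 hr
    obtain ⟨t, ht, ht'⟩ := exists_between (show (1 : ℝ) < (r⁻¹ : PosReal) from h2)
    have := (h ⟨t, zero_lt_one.trans ht⟩ ht).1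
    rw [UProd.diag_le, inv_le'] at this
    exact absurd (lt_of_lt_of_le ht' this) (lt_irrefl _)
  · exact hr
  · obtain ⟨t, ht, ht'⟩ := exists_between (show (1 : ℝ) < r from hr)
    have := (h ⟨t, zero_lt_one.trans ht⟩ ht).2
    rw [UProd.diag_le] at this
    exact absurd (lt_of_lt_of_le ht' this) (lt_irrefl _)

/-- The infinitesimals are the largest convex subgroup which meets the diagonal trivially. -/
theorem infinitesimals_isGreatest :
    IsGreatest {Δ : Subgroup (UProd D fun _ => PosReal) |
      (Δ : Set (UProd D fun _ => PosReal)).OrdConnected ∧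
        Δ ⊓ (UProd.diag D PosReal).range = ⊥} (infinitesimals D) := by
  refine ⟨⟨inferInstance, ?_⟩, ?_⟩
  · rw [eq_bot_iff]
    rintro _ ⟨h, r, rfl⟩
    rw [diag_mem_infinitesimals D h, map_one]
    exact Subgroup.mem_bot.2 rfl
  · rintro Δ ⟨hΔ, hbot⟩
    have key : ∀ g ∈ Δ, ∀ s : PosReal, 1 < s → g ≤ UProd.diag D PosReal s := by
      intro g hg s hs
      by_contra hlt
      have hmem : UProd.diag D PosReal s ∈ Δ ⊓ (UProd.diag D PosReal).range := by
        refine ⟨hΔ.out Δ.one_mem hg ⟨?_, (not_le.1 hlt).le⟩, s, rfl⟩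
        rw [← map_one (UProd.diag D PosReal), UProd.diag_le]
        exact hs.le
      rw [hbot, Subgroup.mem_bot, ← map_one (UProd.diag D PosReal)] at hmem
      exact absurd ((UProd.diag_le D).1 hmem.le) (not_le.2 hs)
    intro g hg s hs
    refine ⟨?_, key g hg s hs⟩
    have := key _ (Δ.inv_mem hg) s hs
    rw [map_inv, inv_le']
    exact this

/-- `Γ_fin`, the subgroup of the finite elements of `Γ`. -/
noncomputable def gammaFin : Subgroup (UValueGroup D K) := (finites D).comap (valueEmbedding D K)

/-- `Γ_inf`, the subgroup of the infinitesimal elements of `Γ`. -/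
noncomputable def gammaInf : Subgroup (UValueGroup D K) :=
  (infinitesimals D).comap (valueEmbedding D K)

/-- `Γ_inf` as a subgroup of `Γ_fin`. -/
noncomputable def gammaInfInFin : Subgroup (gammaFin D K) :=
  (gammaInf D K).subgroupOf (gammaFin D K)

instance : (gammaFin D K : Set (UValueGroup D K)).OrdConnected :=
  ⟨fun _ ha _ hb _ hc => Set.OrdConnected.out
    (inferInstance : (finites D : Set (UProd D fun _ => PosReal)).OrdConnected) ha hb
    ⟨valueEmbedding_mono D K hc.1, valueEmbedding_mono D K hc.2⟩⟩

instance : (gammaInfInFin D K : Set (gammaFin D K)).OrdConnected :=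
  ⟨fun _ ha _ hb _ hc => Set.OrdConnected.out
    (inferInstance : (infinitesimals D : Set (UProd D fun _ => PosReal)).OrdConnected) ha hb
    ⟨valueEmbedding_mono D K hc.1, valueEmbedding_mono D K hc.2⟩⟩

/-! ### The standard part map -/

theorem exists_stdPart {g : UProd D fun _ => PosReal} (hg : g ∈ finites D) :
    ∃ r : PosReal, g * (UProd.diag D PosReal r)⁻¹ ∈ infinitesimals D := by
  obtain ⟨x, rfl⟩ := UProd.mk_surj g
  obtain ⟨r, s, hr, hs⟩ := hg
  obtain ⟨L, hL, hlim⟩ := (isCompact_Icc (a := (r : ℝ)) (b := s)).ultrafilter_le_nhds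
    (D.map fun i => (x i : ℝ)) (by
      rw [le_principal_iff]
      change ∀ᶠ i in (D : Filter ι), (x i : ℝ) ∈ Set.Icc (r : ℝ) s
      filter_upwards [hr, hs] with i h h'
      exact ⟨h, h'⟩)
  have hL0 : 0 < L := r.2.trans_le hL.1
  have hlim : Tendsto (fun i => (x i : ℝ)) D (𝓝 L) := hlim
  have hlim : Tendsto (fun i => (x i : ℝ) * L⁻¹) D (𝓝 1) := by
    have := hlim.mul_const L⁻¹
    rwa [mul_inv_cancel₀ hL0.ne'] at this
  refine ⟨⟨L, hL0⟩, fun t ht => ⟨?_, ?_⟩⟩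
  · have ht' : ((t⁻¹ : PosReal) : ℝ) < 1 := inv_lt_one'.2 ht
    have h : ∀ᶠ i in (D : Filter ι), ((t⁻¹ : PosReal) : ℝ) ≤ (x i : ℝ) * L⁻¹ :=
      hlim.eventually_const_le ht'
    exact h
  · have ht' : 1 < (t : ℝ) := ht
    have h : ∀ᶠ i in (D : Filter ι), (x i : ℝ) * L⁻¹ ≤ (t : ℝ) := hlim.eventually_le_const ht'
    exact h

theorem stdPart_unique {g : UProd D fun _ => PosReal} {r s : PosReal}
    (hr : g * (UProd.diag D PosReal r)⁻¹ ∈ infinitesimals D)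
    (hs : g * (UProd.diag D PosReal s)⁻¹ ∈ infinitesimals D) : r = s := by
  have h := (infinitesimals D).div_mem hs hr
  rw [mul_div_mul_left_eq_div, inv_div_inv, ← map_div] at h
  exact div_eq_one.1 (diag_mem_infinitesimals D h)

/-- The standard part `α : Γ_fin → ℝ⁺`: the real number `r` such that `g / r` is infinitesimal. -/
noncomputable def stdPart : gammaFin D K →* PosReal where
  toFun g := (exists_stdPart D (g := valueEmbedding D K g) g.2).choose
  map_one' := stdPart_unique D
    (exists_stdPart D (g := valueEmbedding D K _) (1 : gammaFin D K).2).choose_spec (by simp)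
  map_mul' a b := by
    refine stdPart_unique D (exists_stdPart D (g := valueEmbedding D K _) (a * b).2).choose_spec ?_
    have ha := (exists_stdPart D (g := valueEmbedding D K a) a.2).choose_spec
    have hb := (exists_stdPart D (g := valueEmbedding D K b) b.2).choose_spec
    have := (infinitesimals D).mul_mem ha hb
    rwa [mul_mul_mul_comm, ← mul_inv, ← map_mul, ← map_mul] at this

theorem stdPart_spec (g : gammaFin D K) :
    valueEmbedding D K g * (UProd.diag D PosReal (stdPart D K g))⁻¹ ∈ infinitesimals D :=
  (exists_stdPart D (g := valueEmbedding D K g) g.2).choose_spec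

/-- The kernel of the standard part map is `Γ_inf`. -/
theorem stdPart_ker : (stdPart D K).ker = gammaInfInFin D K := by
  ext g
  rw [MonoidHom.mem_ker]
  have h := stdPart_spec D K g
  constructor
  · intro h1
    rw [h1, map_one, inv_one, mul_one] at h
    exact h
  · intro h1
    refine stdPart_unique D h ?_
    rw [map_one, inv_one, mul_one]
    exact h1

/-- The ordered group `Γ_fin / Γ_inf`. -/
abbrev gammaBar : Type _ := gammaFin D K ⧸ gammaInfInFin D K

/-- The embedding `Γ_fin / Γ_inf → ℝ⁺` induced by the standard part map. -/
noncomputable def alphaBar : gammaBar D K →* PosReal :=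
  QuotientGroup.lift (gammaInfInFin D K) (stdPart D K) (stdPart_ker D K).ge

theorem stdPart_mono : Monotone (stdPart D K) := by
  intro a b hab
  by_contra hlt
  rw [not_le] at hlt
  obtain ⟨t, ht, ht'⟩ := exists_between (show (1 : ℝ) < (stdPart D K a / stdPart D K b : PosReal)
    from one_lt_div'.2 hlt)
  let s : PosReal := ⟨√t, Real.sqrt_pos.2 (zero_lt_one.trans ht)⟩
  have hs : 1 < s := by
    change (1 : ℝ) < √t
    rwa [Real.lt_sqrt zero_le_one, one_pow]
  have h1 := (stdPart_spec D K a s hs).1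
  have h2 := (stdPart_spec D K b s hs).2
  have h3 : UProd.diag D PosReal (s⁻¹ * stdPart D K a) ≤ UProd.diag D PosReal (s * stdPart D K b) := by
    rw [map_mul, map_mul]
    exact (le_mul_inv_iff_mul_le.1 h1).trans
      ((valueEmbedding_mono D K hab).trans (mul_inv_le_iff_le_mul.1 h2))
  rw [UProd.diag_le, inv_mul_le_iff_le_mul, ← mul_assoc, ← div_le_iff_le_mul] at h3
  have hst : s * s = ⟨t, zero_lt_one.trans ht⟩ :=
    Subtype.ext (Real.mul_self_sqrt (zero_lt_one.trans ht).le)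
  rw [hst] at h3
  exact absurd (lt_of_lt_of_le ht' h3) (lt_irrefl _)

/-- The embedding of `Γ_fin / Γ_inf` into the positive reals preserves the (strict) order. -/
theorem alphaBar_strictMono : StrictMono (alphaBar D K) := by
  refine Monotone.strictMono_of_injective ?_ ?_
  · rintro _ _ ⟨x, y, rfl, rfl, h⟩
    exact stdPart_mono D K h
  · rw [injective_iff_map_eq_one]
    intro a ha
    induction a using QuotientGroup.induction_on with
    | H a =>
    rw [QuotientGroup.eq_one_iff, ← stdPart_ker]
    exact ha

variable [∀ i, IsUltrametricDist (K i)]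

/-- `K̄`, the residue field of the coarsening `v̄ : K → Γ / Γ_fin ∪ {0}` of `v`. -/
abbrev KBar : Type _ := CoarseResidueField (ultraValuation D K) (gammaFin D K)

/-- The valuation `v_fin : K̄ → Γ_fin ∪ {0}` induced by `v` on `K̄`. -/
noncomputable def vFin : Valuation (KBar D K) (WithZero (gammaFin D K)) :=
  inducedValuation (ultraValuation D K) (gammaFin D K)

/-- The coarsening `v̄_fin : K̄ → Γ_fin / Γ_inf ∪ {0}` of `v_fin`. -/
noncomputable def vFinBar : Valuation (KBar D K) (WithZero (gammaBar D K)) :=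
  coarsening (vFin D K) (gammaInfInFin D K)

/-- `alphaBar`, extended by `0 ↦ 0` to a map `Γ_fin / Γ_inf ∪ {0} → ℝ`. -/
noncomputable def alphaBarZero : WithZero (gammaBar D K) → ℝ :=
  WithZero.recZeroCoe 0 fun g => (alphaBar D K g : ℝ)

end UltraValuation

/-! ### Metric structures in the language of projective lines, and their metric ultraproducts -/

/-- The language has a constant symbol `∞` and, for every integer polynomial `P` in `n` variables,
an `n`-ary predicate symbol `‖P‖` with values in `[0,1]` whose modulus of uniform continuity is the
identity (`Fin n → M` carries the maximum metric). A structure is a metric space of diameter at most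
`1` with interpretations of these symbols. (Completeness is not part of this definition.) -/
class LPStructure (M : Type*) extends MetricSpace M where
  infty : M
  pred : ∀ {n : ℕ}, MvPolynomial (Fin n) ℤ → (Fin n → M) → ℝ
  dist_le_one : ∀ x y : M, dist x y ≤ 1
  pred_mem : ∀ {n : ℕ} (P : MvPolynomial (Fin n) ℤ) (x : Fin n → M), pred P x ∈ Set.Icc (0 : ℝ) 1
  pred_lipschitz : ∀ {n : ℕ} (P : MvPolynomial (Fin n) ℤ) (x y : Fin n → M),
    |pred P x - pred P y| ≤ Dist.dist x y

/-- Isomorphisms of structures: bijections preserving the metric, the constant and the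
predicates. -/
structure LPIso (M N : Type*) [LPStructure M] [LPStructure N] extends M ≃ N where
  dist_eq : ∀ x y : M, dist (toEquiv x) (toEquiv y) = dist x y
  map_infty : toEquiv LPStructure.infty = LPStructure.infty
  map_pred : ∀ {n : ℕ} (P : MvPolynomial (Fin n) ℤ) (x : Fin n → M),
    LPStructure.pred P (fun k => toEquiv (x k)) = LPStructure.pred P x

section MetricUltraproduct

/-- The ultralimit of a family of real numbers (used only for families in `[0,1]`). -/
noncomputable def ulim {ι : Type*} (D : Ultrafilter ι) (f : ι → ℝ) : ℝ := limUnder (D : Filter ι) f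

theorem tendsto_ulim {ι : Type*} (D : Ultrafilter ι) {f : ι → ℝ}
    (hf : ∀ i, f i ∈ Set.Icc (0 : ℝ) 1) : Tendsto f D (𝓝 (ulim D f)) := by
  obtain ⟨L, _, hL⟩ := (isCompact_Icc (a := (0 : ℝ)) (b := 1)).ultrafilter_le_nhds (D.map f) (by
    rw [le_principal_iff]
    change ∀ᶠ i in (D : Filter ι), f i ∈ Set.Icc (0 : ℝ) 1
    exact Eventually.of_forall hf)
  exact tendsto_nhds_limUnder ⟨L, hL⟩

variable {ι : Type*} (D : Ultrafilter ι) (M : ι → Type*) [∀ i, LPStructure (M i)]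

/-- The product of the `M i`, with the pseudo-metric `lim_D d(x i, y i)`. -/
def PreMetricUltraproduct (_ : Ultrafilter ι) (M : ι → Type*) : Type _ := ∀ i, M i

theorem dist_mem_Icc {N : Type*} [LPStructure N] (x y : N) : dist x y ∈ Set.Icc (0 : ℝ) 1 :=
  ⟨dist_nonneg, LPStructure.dist_le_one x y⟩

noncomputable instance : PseudoMetricSpace (PreMetricUltraproduct D M) where
  dist x y := ulim D fun i => dist (x i) (y i)
  dist_self x := tendsto_nhds_unique (tendsto_ulim D fun _ => dist_mem_Icc _ _)
    (by simp only [dist_self]; exact tendsto_const_nhds)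
  dist_comm x y := by simp only [dist_comm]
  dist_triangle x y z := le_of_tendsto_of_tendsto' (tendsto_ulim D fun _ => dist_mem_Icc _ _)
    ((tendsto_ulim D fun _ => dist_mem_Icc _ _).add (tendsto_ulim D fun _ => dist_mem_Icc _ _))
    fun _ => dist_triangle _ _ _

/-- The metric ultraproduct: the metric quotient of the product of the `M i` by the relation
`lim_D d(x i, y i) = 0`. -/
def MetricUltraproduct : Type _ := SeparationQuotient (PreMetricUltraproduct D M)

noncomputable instance : MetricSpace (MetricUltraproduct D M) :=
  inferInstanceAs (MetricSpace (SeparationQuotient (PreMetricUltraproduct D M)))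

variable {M} in
/-- The class of a family in the metric ultraproduct. -/
noncomputable def MetricUltraproduct.mk (x : ∀ i, M i) : MetricUltraproduct D M :=
  SeparationQuotient.mk (X := PreMetricUltraproduct D M) x

variable {M} in
theorem MetricUltraproduct.dist_mk (x y : ∀ i, M i) :
    dist (MetricUltraproduct.mk D x) (MetricUltraproduct.mk D y) =
      ulim D fun i => dist (x i) (y i) := rfl

/-- A representative of a class. -/
noncomputable def MetricUltraproduct.out (a : MetricUltraproduct D M) : ∀ i, M i :=
  (SeparationQuotient.surjective_mk (X := PreMetricUltraproduct D M) a).choose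

theorem MetricUltraproduct.mk_out (a : MetricUltraproduct D M) :
    MetricUltraproduct.mk D (MetricUltraproduct.out D M a) = a :=
  (SeparationQuotient.surjective_mk (X := PreMetricUltraproduct D M) a).choose_spec

theorem MetricUltraproduct.lim_pred_lipschitz {n : ℕ} (P : MvPolynomial (Fin n) ℤ)
    (x y : Fin n → ∀ i, M i) :
    |(ulim D fun i => LPStructure.pred P fun k => x k i) -
      ulim D fun i => LPStructure.pred P fun k => y k i| ≤
    dist (fun k => MetricUltraproduct.mk D (x k)) (fun k => MetricUltraproduct.mk D (y k)) := by
  have hx := tendsto_ulim D fun i => LPStructure.pred_mem P fun k => x k i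
  have hy := tendsto_ulim D fun i => LPStructure.pred_mem P fun k => y k i
  have hd : ∀ k, Tendsto (fun i => dist (x k i) (y k i)) D
      (𝓝 (dist (MetricUltraproduct.mk D (x k)) (MetricUltraproduct.mk D (y k)))) :=
    fun k => tendsto_ulim D fun i => dist_mem_Icc _ _
  refine le_of_forall_pos_le_add fun ε hε => le_of_tendsto (hx.sub hy).abs ?_
  have hev : ∀ᶠ i in (D : Filter ι), ∀ k, dist (x k i) (y k i) <
      dist (fun k => MetricUltraproduct.mk D (x k)) (fun k => MetricUltraproduct.mk D (y k)) + ε := by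
    rw [eventually_all]
    intro k
    refine (hd k).eventually_lt_const ?_
    have := dist_le_pi_dist (fun k => MetricUltraproduct.mk D (x k))
      (fun k => MetricUltraproduct.mk D (y k)) k
    linarith
  filter_upwards [hev] with i hi
  refine (LPStructure.pred_lipschitz P _ _).trans ((dist_pi_le_iff (by positivity)).2 fun k => ?_)
  exact (hi k).le

/-- The metric ultraproduct as a structure: `∞` is the class of the constant family `∞`, and
`‖P‖(a) = lim_D ‖P‖(a i)`, computed with representatives. -/
noncomputable instance : LPStructure (MetricUltraproduct D M) where
  infty := MetricUltraproduct.mk D fun _ => LPStructure.infty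
  pred P a := ulim D fun i => LPStructure.pred P fun k => MetricUltraproduct.out D M (a k) i
  dist_le_one x y := by
    rw [← MetricUltraproduct.mk_out D M x, ← MetricUltraproduct.mk_out D M y]
    exact le_of_tendsto' (tendsto_ulim D fun _ => dist_mem_Icc _ _) fun _ =>
      LPStructure.dist_le_one _ _
  pred_mem P a := isClosed_Icc.mem_of_tendsto (tendsto_ulim D fun _ => LPStructure.pred_mem P _)
    (Eventually.of_forall fun _ => LPStructure.pred_mem P _)
  pred_lipschitz P a b := by
    have h := MetricUltraproduct.lim_pred_lipschitz D M P
      (fun k => MetricUltraproduct.out D M (a k)) (fun k => MetricUltraproduct.out D M (b k))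
    simpa only [MetricUltraproduct.mk_out] using h

/-- The predicates of the metric ultraproduct do not depend on the representatives. -/
theorem MetricUltraproduct.pred_mk {n : ℕ} (P : MvPolynomial (Fin n) ℤ) (x : Fin n → ∀ i, M i) :
    LPStructure.pred P (fun k => MetricUltraproduct.mk D (x k)) =
      ulim D fun i => LPStructure.pred P fun k => x k i := by
  have h := MetricUltraproduct.lim_pred_lipschitz D M P
    (fun k => MetricUltraproduct.out D M (MetricUltraproduct.mk D (x k))) x
  simp only [MetricUltraproduct.mk_out, dist_self] at h
  exact sub_eq_zero.1 (abs_nonpos_iff.1 h)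

end MetricUltraproduct

/-! ### The projective line over a metric valued field -/

/-- The homogenisation `P^h` of an integer polynomial `P` in the variables `X i`; it is homogeneous
of degree `deg_{X i} P` in every pair of variables `X i = X (inl i)`, `X* i = X (inr i)`. -/
noncomputable def homogenisation {n : ℕ} (P : MvPolynomial (Fin n) ℤ) :
    MvPolynomial (Fin n ⊕ Fin n) ℤ :=
  ∑ s ∈ P.support, MvPolynomial.C (P.coeff s) *
    ∏ i, (MvPolynomial.X (Sum.inl i) ^ s i *
      MvPolynomial.X (Sum.inr i) ^ (P.degreeOf i - s i))

/-- The projective line `KP¹`. -/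
def ProjLine (K : Type*) [Field K] : Type _ := Projectivization K (Fin 2 → K)

section ProjLine

variable {K : Type*} [NormedField K]

/-- `v = (x, y)` with `max |x| |y| = 1` represents the point `a = [x : y]`. -/
def IsNormalized (a : ProjLine K) (v : Fin 2 → K) : Prop :=
  max ‖v 0‖ ‖v 1‖ = 1 ∧ ∃ hv : v ≠ 0, Projectivization.mk K v hv = a

theorem exists_isNormalized (a : ProjLine K) : ∃ v, IsNormalized a v := by
  induction a using Projectivization.ind with
  | h v hv =>
  have key : ∀ c : K, c ≠ 0 → max ‖v 0‖ ‖v 1‖ = ‖c‖ →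
      ∃ w, IsNormalized (Projectivization.mk K v hv : ProjLine K) w := by
    intro c hc h
    have hcv : c⁻¹ • v ≠ 0 := smul_ne_zero (inv_ne_zero hc) hv
    refine ⟨c⁻¹ • v, ?_, hcv, ?_⟩
    · simp only [Pi.smul_apply, smul_eq_mul, norm_mul]
      rw [← mul_max_of_nonneg _ _ (norm_nonneg _), h, norm_inv,
        inv_mul_cancel₀ (norm_ne_zero_iff.2 hc)]
    · exact (Projectivization.mk_eq_mk_iff' K _ _ hcv hv).2 ⟨c⁻¹, rfl⟩
  rcases le_total ‖v 0‖ ‖v 1‖ with h | h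
  · refine key (v 1) (fun h1 => hv ?_) (max_eq_right h)
    rw [h1, norm_zero, norm_le_zero_iff] at h
    ext j
    fin_cases j
    · exact h
    · exact h1
  · refine key (v 0) (fun h1 => hv ?_) (max_eq_left h)
    rw [h1, norm_zero, norm_le_zero_iff] at h
    ext j
    fin_cases j
    · exact h1
    · exact h

/-- A normalized representative `(a°, a*)` of `a = [a° : a*]`. -/
noncomputable def nrep (a : ProjLine K) : Fin 2 → K := (exists_isNormalized a).choose

theorem nrep_spec (a : ProjLine K) : IsNormalized a (nrep a) := (exists_isNormalized a).choose_spec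

theorem exists_unit_smul {a : ProjLine K} {v : Fin 2 → K} (h : IsNormalized a v) :
    ∃ u : K, ‖u‖ = 1 ∧ v = fun j => u * nrep a j := by
  obtain ⟨h1, hv, hva⟩ := h
  obtain ⟨h1', hw, hwa⟩ := nrep_spec a
  obtain ⟨u, hu⟩ := (Projectivization.mk_eq_mk_iff' K _ _ hv hw).1 (hva.trans hwa.symm)
  have hu' : ∀ j, v j = u * nrep a j := fun j => (congrFun hu j).symm
  refine ⟨u, ?_, funext hu'⟩
  rw [hu', hu', norm_mul, norm_mul, ← mul_max_of_nonneg _ _ (norm_nonneg _), h1', mul_one] at h1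
  exact h1

/-- `v° w* - v* w°`. -/
def wedge (v w : Fin 2 → K) : K := v 0 * w 1 - v 1 * w 0

theorem wedge_swap (v w : Fin 2 → K) : wedge v w = -wedge w v := by
  simp only [wedge]
  ring

/-- The value `P^h(v°, v*)` for a tuple `v` of pairs `(v°, v*)`. -/
noncomputable def homEval {n : ℕ} (P : MvPolynomial (Fin n) ℤ) (v : Fin n → Fin 2 → K) : K :=
  MvPolynomial.aeval (Sum.elim (fun i => v i 0) (fun i => v i 1)) (homogenisation P)

theorem homEval_smul {n : ℕ} (P : MvPolynomial (Fin n) ℤ) (u : Fin n → K)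
    (v : Fin n → Fin 2 → K) :
    homEval P (fun i j => u i * v i j) =
      (∏ i, u i ^ P.degreeOf i) * homEval P v := by
  simp only [homEval, homogenisation, map_sum, map_mul, map_prod, map_pow, MvPolynomial.aeval_X,
    Sum.elim_inl, Sum.elim_inr, Finset.mul_sum]
  refine Finset.sum_congr rfl fun s hs => ?_
  rw [mul_left_comm, ← Finset.prod_mul_distrib]
  rw [MvPolynomial.aeval_C, MvPolynomial.aeval_C]
  congr 1
  refine Finset.prod_congr rfl fun i _ => ?_
  have h := MvPolynomial.monomial_le_degreeOf i hs
  conv_rhs => rw [← Nat.add_sub_cancel' h, Nat.add_sub_cancel_left, pow_add]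
  rw [mul_pow, mul_pow]
  ring

variable [IsUltrametricDist K]

theorem ultra_norm_sub_le (x y : K) : ‖x - y‖ ≤ max ‖x‖ ‖y‖ := by
  rw [sub_eq_add_neg, ← norm_neg y]
  exact IsUltrametricDist.norm_add_le_max _ _

theorem wedge_le_one {v w : Fin 2 → K} (hv : max ‖v 0‖ ‖v 1‖ = 1) (hw : max ‖w 0‖ ‖w 1‖ = 1) :
    ‖wedge v w‖ ≤ 1 := by
  refine (ultra_norm_sub_le _ _).trans (max_le ?_ ?_) <;> rw [norm_mul]
  · exact mul_le_one₀ (hv ▸ le_max_left _ _) (norm_nonneg _) (hw ▸ le_max_right _ _)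
  · exact mul_le_one₀ (hv ▸ le_max_right _ _) (norm_nonneg _) (hw ▸ le_max_left _ _)

theorem wedge_triangle {u v w : Fin 2 → K} (hu : max ‖u 0‖ ‖u 1‖ = 1)
    (hv : max ‖v 0‖ ‖v 1‖ = 1) (hw : max ‖w 0‖ ‖w 1‖ = 1) :
    ‖wedge u w‖ ≤ max ‖wedge u v‖ ‖wedge v w‖ := by
  have key : ∀ j, ‖wedge u w‖ * ‖v j‖ ≤ max ‖wedge u v‖ ‖wedge v w‖ := by
    intro j
    have h : wedge u w * v j = wedge u v * w j + wedge v w * u j := by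
      fin_cases j <;> simp only [wedge, Fin.zero_eta, Fin.mk_one] <;> ring
    rw [← norm_mul, h]
    refine (IsUltrametricDist.norm_add_le_max _ _).trans (max_le_max ?_ ?_) <;> rw [norm_mul]
    · refine mul_le_of_le_one_right (norm_nonneg _) ?_
      fin_cases j
      · exact hw ▸ le_max_left _ _
      · exact hw ▸ le_max_right _ _
    · refine mul_le_of_le_one_right (norm_nonneg _) ?_
      fin_cases j
      · exact hu ▸ le_max_left _ _
      · exact hu ▸ le_max_right _ _
  rcases max_choice ‖v 0‖ ‖v 1‖ with h | h
  · have := key 0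
    rwa [← h, hv, mul_one] at this
  · have := key 1
    rwa [← h, hv, mul_one] at this

theorem exists_close {v w : Fin 2 → K} (hv : max ‖v 0‖ ‖v 1‖ = 1) (hw : max ‖w 0‖ ‖w 1‖ = 1)
    (h : ‖wedge v w‖ < 1) : ∃ u : K, ‖u‖ = 1 ∧ ∀ j, ‖v j - u * w j‖ ≤ ‖wedge v w‖ := by
  have key : ∀ a b c d : K, max ‖a‖ ‖b‖ = 1 → ‖c‖ = 1 → ‖d‖ ≤ 1 → ‖a * d - b * c‖ < 1 →
      ‖a * c⁻¹‖ = 1 ∧ a - a * c⁻¹ * c = 0 ∧ ‖b - a * c⁻¹ * d‖ = ‖a * d - b * c‖ := by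
    intro a b c d hab hc hd h
    have hc0 : c ≠ 0 := fun h0 => by simp [h0] at hc
    refine ⟨?_, by rw [inv_mul_cancel_right₀ hc0, sub_self], ?_⟩
    · rw [norm_mul, norm_inv, hc, inv_one, mul_one]
      refine le_antisymm (hab ▸ le_max_left _ _) (not_lt.1 fun ha => ?_)
      have hb : ‖b‖ = 1 := by
        rcases max_choice ‖a‖ ‖b‖ with h' | h'
        · exact absurd (h'.symm.trans hab) ha.ne
        · exact h'.symm.trans hab
      have h1 : ‖a * d‖ < 1 := by
        rw [norm_mul]
        exact (mul_le_of_le_one_right (norm_nonneg _) hd).trans_lt ha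
      have h2 : ‖a * d - (a * d - b * c)‖ < 1 :=
        (ultra_norm_sub_le _ _).trans_lt (max_lt h1 h)
      rw [sub_sub_cancel, norm_mul, hb, hc, mul_one] at h2
      exact lt_irrefl _ h2
    · have : b - a * c⁻¹ * d = -((a * d - b * c) * c⁻¹) := by
        field_simp
        ring
      rw [this, norm_neg, norm_mul, norm_inv, hc, inv_one, mul_one]
  rcases max_choice ‖w 0‖ ‖w 1‖ with h' | h'
  · obtain ⟨h1, h2, h3⟩ := key (v 0) (v 1) (w 0) (w 1) hv (h'.symm.trans hw)
      (hw ▸ le_max_right _ _) h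
    refine ⟨_, h1, fun j => ?_⟩
    fin_cases j
    · change ‖v 0 - v 0 * (w 0)⁻¹ * w 0‖ ≤ _
      rw [h2, norm_zero]
      exact norm_nonneg _
    · exact h3.le
  · have hsw : ‖wedge v w‖ = ‖v 1 * w 0 - v 0 * w 1‖ := by rw [wedge, norm_sub_rev]
    obtain ⟨h1, h2, h3⟩ := key (v 1) (v 0) (w 1) (w 0) (max_comm ‖v 0‖ ‖v 1‖ ▸ hv)
      (h'.symm.trans hw) (hw ▸ le_max_left _ _) (hsw ▸ h)
    refine ⟨_, h1, fun j => ?_⟩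
    fin_cases j
    · exact h3.le.trans hsw.ge
    · change ‖v 1 - v 1 * (w 1)⁻¹ * w 1‖ ≤ _
      rw [h2, norm_zero]
      exact norm_nonneg _

theorem aeval_close {σ : Type*} (Q : MvPolynomial σ ℤ) {x y : σ → K} {ε : ℝ} (hε : 0 ≤ ε)
    (hx : ∀ j, ‖x j‖ ≤ 1) (hy : ∀ j, ‖y j‖ ≤ 1) (hxy : ∀ j, ‖x j - y j‖ ≤ ε) :
    ‖MvPolynomial.aeval x Q‖ ≤ 1 ∧ ‖MvPolynomial.aeval y Q‖ ≤ 1 ∧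
      ‖MvPolynomial.aeval x Q - MvPolynomial.aeval y Q‖ ≤ ε := by
  induction Q using MvPolynomial.induction_on with
  | C a =>
    rw [MvPolynomial.aeval_C, MvPolynomial.aeval_C, sub_self, norm_zero, algebraMap_int_eq,
      eq_intCast]
    exact ⟨IsUltrametricDist.norm_intCast_le_one _ _, IsUltrametricDist.norm_intCast_le_one _ _, hε⟩
  | add p q hp hq =>
    simp only [map_add]
    refine ⟨(IsUltrametricDist.norm_add_le_max _ _).trans (max_le hp.1 hq.1),
      (IsUltrametricDist.norm_add_le_max _ _).trans (max_le hp.2.1 hq.2.1), ?_⟩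
    rw [add_sub_add_comm]
    exact (IsUltrametricDist.norm_add_le_max _ _).trans (max_le hp.2.2 hq.2.2)
  | mul_X p j hp =>
    simp only [map_mul, MvPolynomial.aeval_X]
    refine ⟨?_, ?_, ?_⟩
    · rw [norm_mul]
      exact mul_le_one₀ hp.1 (norm_nonneg _) (hx j)
    · rw [norm_mul]
      exact mul_le_one₀ hp.2.1 (norm_nonneg _) (hy j)
    · set a := MvPolynomial.aeval x p
      set b := MvPolynomial.aeval y p
      have : a * x j - b * y j = (a - b) * x j + b * (x j - y j) := by ring
      rw [this]
      refine (IsUltrametricDist.norm_add_le_max _ _).trans (max_le ?_ ?_) <;> rw [norm_mul]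
      · exact (mul_le_of_le_one_right (norm_nonneg _) (hx j)).trans hp.2.2
      · exact (mul_le_of_le_one_left (norm_nonneg _) hp.2.1).trans (hxy j)

theorem homEval_close {n : ℕ} (P : MvPolynomial (Fin n) ℤ) {v w : Fin n → Fin 2 → K}
    (hv : ∀ i, max ‖v i 0‖ ‖v i 1‖ = 1) (hw : ∀ i, max ‖w i 0‖ ‖w i 1‖ = 1) {ε : ℝ} (hε : 0 ≤ ε)
    (h : ∀ i, ‖wedge (v i) (w i)‖ ≤ ε) :
    ‖homEval P v‖ ≤ 1 ∧ |‖homEval P v‖ - ‖homEval P w‖| ≤ ε := by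
  have hnorm : ∀ v : Fin n → Fin 2 → K, (∀ i, max ‖v i 0‖ ‖v i 1‖ = 1) →
      ∀ j, ‖(Sum.elim (fun i => v i 0) (fun i => v i 1) : Fin n ⊕ Fin n → K) j‖ ≤ 1 := by
    rintro v hv (j | j)
    · exact hv j ▸ le_max_left _ _
    · exact hv j ▸ le_max_right _ _
  have hle : ∀ v : Fin n → Fin 2 → K, (∀ i, max ‖v i 0‖ ‖v i 1‖ = 1) → ‖homEval P v‖ ≤ 1 :=
    fun v hv => (aeval_close (homogenisation P) le_rfl (hnorm v hv) (hnorm v hv)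
      fun j => by simp).1
  refine ⟨hle v hv, ?_⟩
  rcases lt_or_ge ε 1 with h1 | h1
  · choose u hu hu' using fun i => exists_close (hv i) (hw i) ((h i).trans_lt h1)
    have huw : ∀ i, max ‖u i * w i 0‖ ‖u i * w i 1‖ = 1 := by
      intro i
      rw [norm_mul, norm_mul, hu, one_mul, one_mul, hw]
    have heq : ‖homEval P w‖ = ‖homEval P (fun i j => u i * w i j)‖ := by
      rw [homEval_smul, norm_mul, norm_prod]
      simp [hu]
    rw [heq]
    refine (abs_norm_sub_norm_le _ _).trans ?_
    refine (aeval_close (homogenisation P) hε (hnorm v hv)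
      (hnorm (fun i j => u i * w i j) huw) ?_).2.2
    rintro (j | j)
    · exact (hu' j 0).trans (h j)
    · exact (hu' j 1).trans (h j)
  · have h2 := hle v hv
    have h3 := hle w hw
    rw [abs_le]
    constructor <;> linarith [norm_nonneg (homEval P v), norm_nonneg (homEval P w)]

/-- The metric `d(a, b) = |a° b* - a* b°|` on the projective line. -/
noncomputable instance : MetricSpace (ProjLine K) where
  dist a b := ‖wedge (nrep a) (nrep b)‖
  dist_self a := by
    rw [wedge, mul_comm, sub_self, norm_zero]
  dist_comm a b := by rw [wedge_swap, norm_neg]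
  dist_triangle a b c := by
    refine (wedge_triangle (nrep_spec a).1 (nrep_spec b).1 (nrep_spec c).1).trans ?_
    exact max_le_add_of_nonneg (norm_nonneg _) (norm_nonneg _)
  eq_of_dist_eq_zero {a b} h := by
    change ‖wedge (nrep a) (nrep b)‖ = 0 at h
    obtain ⟨u, _, hu⟩ := exists_close (nrep_spec a).1 (nrep_spec b).1 (h ▸ zero_lt_one)
    obtain ⟨_, hv, hva⟩ := nrep_spec a
    obtain ⟨_, hw, hwb⟩ := nrep_spec b
    refine hva.symm.trans (((Projectivization.mk_eq_mk_iff' K _ _ hv hw).2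
      ⟨u, funext fun j => ?_⟩).trans hwb)
    have := hu j
    rw [h, norm_le_zero_iff, sub_eq_zero] at this
    exact this.symm

/-- The projective line as a structure: `∞ = [1 : 0]` and `‖P‖(a) = |P^h(a°, a*)|`. -/
noncomputable instance : LPStructure (ProjLine K) where
  infty := Projectivization.mk K ![1, 0] (fun h => one_ne_zero (congrFun h 0))
  pred P a := ‖homEval P fun i => nrep (a i)‖
  dist_le_one a b := wedge_le_one (nrep_spec a).1 (nrep_spec b).1
  pred_mem P a := ⟨norm_nonneg _, (homEval_close P (fun i => (nrep_spec (a i)).1)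
    (fun i => (nrep_spec (a i)).1) zero_le_one
    fun i => wedge_le_one (nrep_spec (a i)).1 (nrep_spec (a i)).1).1⟩
  pred_lipschitz P a b := (homEval_close P (fun i => (nrep_spec (a i)).1)
    (fun i => (nrep_spec (b i)).1) dist_nonneg fun i => dist_le_pi_dist a b i).2

/-- The metric does not depend on the normalized representatives. -/
theorem dist_eq_wedge {a b : ProjLine K} {v w : Fin 2 → K} (hv : IsNormalized a v)
    (hw : IsNormalized b w) : dist a b = ‖v 0 * w 1 - v 1 * w 0‖ := by
  obtain ⟨u, hu, rfl⟩ := exists_unit_smul hv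
  obtain ⟨u', hu', rfl⟩ := exists_unit_smul hw
  have : u * nrep a 0 * (u' * nrep b 1) - u * nrep a 1 * (u' * nrep b 0) =
    u * u' * wedge (nrep a) (nrep b) := by
    rw [wedge]
    ring
  rw [this, norm_mul, norm_mul, hu, hu', one_mul, one_mul]
  rfl

/-- The predicates do not depend on the normalized representatives. -/
theorem pred_eq_homEval {n : ℕ} (P : MvPolynomial (Fin n) ℤ) {a : Fin n → ProjLine K}
    {v : Fin n → Fin 2 → K} (hv : ∀ i, IsNormalized (a i) (v i)) :
    LPStructure.pred P a = ‖homEval P v‖ := by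
  choose u hu huv using fun i => exists_unit_smul (hv i)
  have : v = fun i j => u i * nrep (a i) j := funext huv
  rw [this, homEval_smul, norm_mul, norm_prod]
  simp only [norm_pow, hu, one_pow, Finset.prod_const_one, one_mul]
  rfl

end ProjLine

/-- `F` is the underlying metric valued field of the structure `M`: its projective line `FP¹` is
isomorphic to `M`. -/
def IsUnderlyingField (F : Type*) [NormedField F] [IsUltrametricDist F] (M : Type*)
    [LPStructure M] : Prop :=
  Nonempty (LPIso (ProjLine F) M)

universe u v w

/-!
The theorem holds because both sides are the same ultralimit of the fields `K i`: the ring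
`boundedFamilies D K` of the families bounded along `D`, modulo the families with limit `0`, with
the absolute value `lim_D |x i|`.

For the classical side, a family is bounded exactly when its class lies in the valuation ring of
the coarsening of `v` by `Γ_fin`, and it tends to `0` exactly when that class lies in the maximal
ideal. The standard part of a finite value is its limit, so `ᾱ ∘ v̄_fin` is the limit of the absolute
values (`tendsto_alphaBarZero_vFinBar`), and `K̄` is the image of the bounded families
(`boundedResidue_surjective`).

For the metric side, let `π : boundedFamilies D K → F` be a surjective ring homomorphism to a normed
field with `|π x| = lim_D |x i|`. A family of points with normalized representatives `(x i, y i)` has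
the limit point `[π x : π y]`. Metric and predicates are absolute values of integer polynomials in
normalized coordinates, so they pass to the limit, and the limit point identifies the metric
ultraproduct of the `K i P¹` with `FP¹` (`isUnderlyingField_of_surjective`). Such an `F` is complete
for every ultrafilter (`completeSpace_of_surjective`). With `F = K̄` this gives existence.

An isomorphism of projective lines comes from an isometric isomorphism of fields
(`LPIso.exists_ringEquiv`): a field is recovered from its projective line as the set of points
`[x : 1]` other than `∞`, with addition and multiplication given by the zero sets of the predicates
of `X + Y - Z` and `XY - Z`, and with `|x| = d(x, 0) / d(x, ∞)`. Hence every underlying metric valued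
field is isometrically isomorphic to `K̄`.
-/

/-! ### Isomorphisms of structures -/

section Iso

variable {M N R : Type*} [LPStructure M] [LPStructure N] [LPStructure R]

/-- The inverse of an isomorphism of structures. -/
def LPIso.symm (e : LPIso M N) : LPIso N M where
  toEquiv := e.toEquiv.symm
  dist_eq x y := by
    have h := e.dist_eq (e.toEquiv.symm x) (e.toEquiv.symm y)
    rw [Equiv.apply_symm_apply, Equiv.apply_symm_apply] at h
    exact h.symm
  map_infty := by rw [Equiv.symm_apply_eq, e.map_infty]
  map_pred P x := by
    have h := e.map_pred P fun k => e.toEquiv.symm (x k)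
    simp only [Equiv.apply_symm_apply] at h
    exact h.symm

/-- The composition of isomorphisms of structures. -/
def LPIso.trans (e : LPIso M N) (e' : LPIso N R) : LPIso M R where
  toEquiv := e.toEquiv.trans e'.toEquiv
  dist_eq _ _ := (e'.dist_eq _ _).trans (e.dist_eq _ _)
  map_infty := (congrArg e'.toEquiv e.map_infty).trans e'.map_infty
  map_pred P x := (e'.map_pred P _).trans (e.map_pred P x)

end Iso

/-! ### The field of affine points of a projective line -/

section AffinePoints

variable {F : Type*} [NormedField F]

/-- The point `[x : 1]` of the projective line. -/
def ProjLine.affine (x : F) : ProjLine F :=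
  Projectivization.mk F ![x, 1] fun h => one_ne_zero (congrFun h 1)

theorem exists_smul_isNormalized {v : Fin 2 → F} (hv : v ≠ 0) :
    ∃ c : F, ‖c‖ * max ‖v 0‖ ‖v 1‖ = 1 ∧
      IsNormalized (Projectivization.mk F v hv : ProjLine F) fun j => c * v j := by
  obtain ⟨w, hw1, hw, hwv⟩ := exists_isNormalized (Projectivization.mk F v hv : ProjLine F)
  obtain ⟨c, rfl⟩ := (Projectivization.mk_eq_mk_iff' F _ _ hw hv).1 hwv
  refine ⟨c, ?_, hw1, hw, hwv⟩
  rw [mul_max_of_nonneg _ _ (norm_nonneg _), ← norm_mul, ← norm_mul]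
  exact hw1

theorem ProjLine.affine_injective : Function.Injective (ProjLine.affine (F := F)) := by
  intro x y h
  obtain ⟨c, hc⟩ := (Projectivization.mk_eq_mk_iff' F _ _ _ _).1 h
  have h0 : c * y = x := congrFun hc 0
  have h1 : c * 1 = 1 := congrFun hc 1
  rw [← h0, ← mul_one c, h1, one_mul]

theorem homEval_affine {n : ℕ} (P : MvPolynomial (Fin n) ℤ) (x : Fin n → F) :
    homEval P (fun i => ![x i, 1]) = MvPolynomial.aeval x P := by
  rw [homEval, homogenisation, MvPolynomial.aeval_def x, MvPolynomial.eval₂_eq']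
  simp

variable [IsUltrametricDist F]

theorem ProjLine.affine_ne_infty (x : F) : ProjLine.affine x ≠ LPStructure.infty := by
  intro h
  obtain ⟨c, hc⟩ := (Projectivization.mk_eq_mk_iff' F _ _ _ _).1 h
  have h1 : c * 0 = 1 := congrFun hc 1
  simp at h1

theorem ProjLine.exists_affine {a : ProjLine F} (ha : a ≠ LPStructure.infty) :
    ∃ x, ProjLine.affine x = a := by
  induction a using Projectivization.ind with
  | h v hv =>
  have h1 : v 1 ≠ 0 := by
    intro h1
    refine ha ((Projectivization.mk_eq_mk_iff' F _ _ hv _).2 ⟨v 0, funext fun j => ?_⟩)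
    fin_cases j
    · simp
    · simp [h1]
  refine ⟨v 0 / v 1, (Projectivization.mk_eq_mk_iff' F _ _ _ hv).2 ⟨(v 1)⁻¹, funext fun j => ?_⟩⟩
  fin_cases j
  · simp [div_eq_inv_mul]
  · simp [h1]

theorem ProjLine.isNormalized_infty :
    IsNormalized (LPStructure.infty : ProjLine F) ![1, 0] := by
  refine ⟨?_, fun h => one_ne_zero (congrFun h 0), rfl⟩
  simp

theorem ProjLine.dist_affine_infty (x : F) :
    dist (ProjLine.affine x) LPStructure.infty = (max ‖x‖ 1)⁻¹ := by
  obtain ⟨c, hc, hn⟩ := exists_smul_isNormalized (v := ![x, 1])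
    fun h => one_ne_zero (congrFun h 1)
  refine (dist_eq_wedge hn isNormalized_infty).trans ?_
  simp at hc ⊢
  exact eq_inv_of_mul_eq_one_left hc

theorem ProjLine.dist_affine_zero (x : F) :
    dist (ProjLine.affine x) (ProjLine.affine 0) = ‖x‖ * (max ‖x‖ 1)⁻¹ := by
  obtain ⟨c, hc, hn⟩ := exists_smul_isNormalized (v := ![x, 1])
    fun h => one_ne_zero (congrFun h 1)
  have h0 : IsNormalized (ProjLine.affine (0 : F)) ![0, 1] :=
    ⟨by simp, fun h => one_ne_zero (congrFun h 1), rfl⟩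
  refine (dist_eq_wedge hn h0).trans ?_
  simp at hc ⊢
  rw [eq_inv_of_mul_eq_one_left hc, mul_comm]

/-- The absolute value is determined by the metric and the points `∞`, `0`. -/
theorem ProjLine.norm_eq_dist_div_dist (x : F) :
    ‖x‖ = dist (ProjLine.affine x) (ProjLine.affine 0) /
      dist (ProjLine.affine x) LPStructure.infty := by
  have h : max ‖x‖ 1 ≠ 0 := (zero_lt_one.trans_le (le_max_right _ _)).ne'
  rw [dist_affine_infty, dist_affine_zero, mul_div_cancel_right₀ _ (inv_ne_zero h)]

/-- The zero sets of the predicates carry the algebraic relations between affine points. -/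
theorem ProjLine.pred_affine_eq_zero {n : ℕ} (P : MvPolynomial (Fin n) ℤ) (x : Fin n → F) :
    LPStructure.pred P (fun i => ProjLine.affine (x i)) = 0 ↔ MvPolynomial.aeval x P = 0 := by
  choose c hc hn using fun i => exists_smul_isNormalized (v := ![x i, 1])
    fun h => one_ne_zero (congrFun h 1)
  have hc0 : ∀ i, c i ≠ 0 := fun i h => by simpa [h] using hc i
  have hn' : ∀ i, IsNormalized (ProjLine.affine (x i)) fun j => c i * ![x i, 1] j := hn
  rw [pred_eq_homEval P hn', homEval_smul, norm_eq_zero, homEval_affine, mul_eq_zero,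
    or_iff_right (Finset.prod_ne_zero_iff.2 fun i _ => pow_ne_zero _ (hc0 i))]

/-- An isomorphism of projective lines fixes `∞`, hence acts on the affine points; it respects
sums and products there, because their graphs are zero sets of predicates. -/
theorem LPIso.exists_ringEquiv {E : Type*} [NormedField E] [IsUltrametricDist E]
    (e : LPIso (ProjLine F) (ProjLine E)) : ∃ f : F ≃+* E, ∀ x, ‖f x‖ = ‖x‖ := by
  have key : ∀ x, ∃ y, ProjLine.affine y = e.toEquiv (ProjLine.affine x) := fun x =>
    ProjLine.exists_affine fun h =>
      ProjLine.affine_ne_infty x (e.toEquiv.injective (h.trans e.map_infty.symm))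
  choose f hf using key
  have hinj : Function.Injective f := fun x y h =>
    ProjLine.affine_injective (e.toEquiv.injective (by rw [← hf, ← hf, h]))
  have hsurj : Function.Surjective f := by
    intro y
    obtain ⟨a, ha⟩ := e.toEquiv.surjective (ProjLine.affine y)
    have hne : a ≠ LPStructure.infty := by
      rintro rfl
      exact ProjLine.affine_ne_infty y (ha.symm.trans e.map_infty)
    obtain ⟨x, rfl⟩ := ProjLine.exists_affine hne
    exact ⟨x, ProjLine.affine_injective ((hf x).trans ha)⟩
  have hP : ∀ {n : ℕ} (P : MvPolynomial (Fin n) ℤ) (x : Fin n → F),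
      MvPolynomial.aeval x P = 0 → MvPolynomial.aeval (fun i => f (x i)) P = 0 := by
    intro n P x h
    rw [← ProjLine.pred_affine_eq_zero] at h ⊢
    simp only [hf]
    rw [e.map_pred, h]
  let g : F ≃+* E :=
    { Equiv.ofBijective f ⟨hinj, hsurj⟩ with
      map_add' := fun x y => by
        change f (x + y) = f x + f y
        have h := hP (MvPolynomial.X 0 + MvPolynomial.X 1 - MvPolynomial.X 2) ![x, y, x + y]
          (by simp)
        simpa [sub_eq_zero, eq_comm] using h
      map_mul' := fun x y => by
        change f (x * y) = f x * f y
        have h := hP (MvPolynomial.X 0 * MvPolynomial.X 1 - MvPolynomial.X 2) ![x, y, x * y]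
          (by simp)
        simpa [sub_eq_zero, eq_comm] using h }
  have hg0 : f 0 = 0 := map_zero g
  refine ⟨g, fun x => ?_⟩
  change ‖f x‖ = ‖x‖
  rw [ProjLine.norm_eq_dist_div_dist (f x), ProjLine.norm_eq_dist_div_dist x, ← hg0, hf, hf,
    e.dist_eq, ← e.map_infty, e.dist_eq]

end AffinePoints

/-! ### Ultralimits of metric valued fields and of their projective lines -/

theorem homEval_map {F R : Type*} [NormedField F] [CommRing R] (f : R →+* F) {n : ℕ}
    (P : MvPolynomial (Fin n) ℤ) (x : Fin n → Fin 2 → R) :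
    (homEval P fun k j => f (x k j)) =
      f (MvPolynomial.aeval (Sum.elim (fun k => x k 0) fun k => x k 1) (homogenisation P)) := by
  refine Eq.trans ?_ (MvPolynomial.comp_aeval_apply _ f.toIntAlgHom _).symm
  rw [homEval]
  congr 2
  ext (k | k) <;> rfl

section BoundedFamilies

variable {ι : Type*} (D : Ultrafilter ι) (K : ι → Type*) [∀ i, NormedField (K i)]

/-- The ring of the families that are bounded along `D`. -/
def boundedFamilies : Subring (∀ i, K i) where
  carrier := {x | ∃ C : ℝ, ∀ᶠ i in (D : Filter ι), ‖x i‖ ≤ C}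
  zero_mem' := ⟨0, by simp⟩
  one_mem' := ⟨1, by simp⟩
  add_mem' := by
    rintro x y ⟨C, hC⟩ ⟨C', hC'⟩
    refine ⟨C + C', ?_⟩
    filter_upwards [hC, hC'] with i h h'
    exact (norm_add_le _ _).trans (add_le_add h h')
  mul_mem' := by
    rintro x y ⟨C, hC⟩ ⟨C', hC'⟩
    refine ⟨C * C', ?_⟩
    filter_upwards [hC, hC'] with i h h'
    exact (norm_mul_le _ _).trans
      (mul_le_mul h h' (norm_nonneg _) ((norm_nonneg _).trans h))
  neg_mem' := by
    rintro x ⟨C, hC⟩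
    exact ⟨C, by simpa using hC⟩

variable {D K}

/-- A normalized family of pairs, as a pair of bounded families. -/
noncomputable def boundedRep (a : ∀ i, ProjLine (K i)) (j : Fin 2) : boundedFamilies D K :=
  ⟨fun i => nrep (a i) j, 1, Eventually.of_forall fun i => by
    have h := (nrep_spec (a i)).1
    fin_cases j
    · exact h ▸ le_max_left _ _
    · exact h ▸ le_max_right _ _⟩

variable {F : Type*} [NormedField F]
  {π : boundedFamilies D K →+* F}
  (hπ : ∀ x : boundedFamilies D K, Tendsto (fun i => ‖x.1 i‖) D (𝓝 ‖π x‖))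
include hπ

theorem eq_of_eventuallyEq {x y : boundedFamilies D K}
    (h : ∀ᶠ i in (D : Filter ι), x.1 i = y.1 i) : π x = π y := by
  rw [← sub_eq_zero, ← map_sub, ← norm_eq_zero]
  refine tendsto_nhds_unique (hπ (x - y)) (tendsto_const_nhds.congr' ?_)
  filter_upwards [h] with i hi
  change 0 = ‖x.1 i - y.1 i‖
  rw [hi, sub_self, norm_zero]

theorem max_norm_eq_one {x y : boundedFamilies D K}
    (h : ∀ᶠ i in (D : Filter ι), max ‖x.1 i‖ ‖y.1 i‖ = 1) : max ‖π x‖ ‖π y‖ = 1 :=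
  tendsto_nhds_unique ((hπ x).max (hπ y)) (tendsto_const_nhds.congr' (h.mono fun _ hi => hi.symm))

theorem max_norm_boundedRep (a : ∀ i, ProjLine (K i)) :
    max ‖π (boundedRep a 0)‖ ‖π (boundedRep a 1)‖ = 1 :=
  max_norm_eq_one hπ (Eventually.of_forall fun i => (nrep_spec (a i)).1)

theorem boundedRep_ne_zero (a : ∀ i, ProjLine (K i)) :
    (fun j => π (boundedRep a j)) ≠ 0 := by
  intro h
  have h1 := max_norm_boundedRep hπ a
  rw [congrFun h 0, congrFun h 1] at h1
  simp at h1

/-- The limit of a family of points of the projective lines over the `K i`. -/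
noncomputable def limPoint (a : ∀ i, ProjLine (K i)) : ProjLine F :=
  Projectivization.mk F (fun j => π (boundedRep a j)) (boundedRep_ne_zero hπ a)

theorem isNormalized_limPoint (a : ∀ i, ProjLine (K i)) :
    IsNormalized (limPoint hπ a) fun j => π (boundedRep a j) :=
  ⟨max_norm_boundedRep hπ a, boundedRep_ne_zero hπ a, rfl⟩

theorem tendsto_norm_homEval {n : ℕ} (P : MvPolynomial (Fin n) ℤ)
    (x : Fin n → Fin 2 → boundedFamilies D K) :
    Tendsto (fun i => ‖homEval P fun k j => (x k j).1 i‖) D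
      (𝓝 ‖homEval P fun k j => π (x k j)‖) := by
  have h : ∀ i, (homEval P fun k j => (x k j).1 i) =
      (MvPolynomial.aeval (Sum.elim (fun k => x k 0) fun k => x k 1) (homogenisation P) :
        boundedFamilies D K).1 i :=
    fun i => homEval_map ((Pi.evalRingHom K i).comp (boundedFamilies D K).subtype) P x
  simp only [h, homEval_map π]
  exact hπ _

variable [∀ i, IsUltrametricDist (K i)]

theorem isUltrametricDist_of_surjective (hs : Function.Surjective π) : IsUltrametricDist F := by
  refine IsUltrametricDist.isUltrametricDist_of_forall_norm_add_le_max_norm fun x y => ?_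
  obtain ⟨x, rfl⟩ := hs x
  obtain ⟨y, rfl⟩ := hs y
  rw [← map_add]
  exact le_of_tendsto_of_tendsto' (hπ (x + y)) ((hπ x).max (hπ y))
    fun i => IsUltrametricDist.norm_add_le_max _ _

/-- Representatives of a rapidly convergent sequence can be changed, outside a set in `D`, into
sequences which converge rapidly at every index; the coordinatewise limits then represent the
limit. No incompleteness of `D` is needed, as every `K i` is complete. -/
theorem completeSpace_of_surjective [∀ i, CompleteSpace (K i)] (hs : Function.Surjective π) :
    CompleteSpace F := by
  classical
  refine Metric.complete_of_convergent_controlled_sequences (fun n => 1 / 2 / 2 ^ n)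
    (fun n => by positivity) fun u hu => ?_
  choose x hx using fun n => hs (u n)
  -- `y n` agrees with `x n` almost everywhere, but never moves by more than `1 / 2 ^ (n + 1)`.
  let y : ℕ → ∀ i, K i := fun n i => Nat.rec ((x 0).1 i) (fun m z =>
    if ‖(x (m + 1)).1 i - z‖ ≤ 1 / 2 / 2 ^ m then (x (m + 1)).1 i else z) n
  have hy : ∀ n i, y (n + 1) i =
      if ‖(x (n + 1)).1 i - y n i‖ ≤ 1 / 2 / 2 ^ n then (x (n + 1)).1 i else y n i :=
    fun n i => rfl
  have hyd : ∀ i n, dist (y n i) (y (n + 1) i) ≤ 1 / 2 / 2 ^ n := by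
    intro i n
    rw [hy]
    split_ifs with h
    · rwa [dist_comm, dist_eq_norm]
    · rw [dist_self]
      positivity
  have hyx : ∀ n, ∀ᶠ i in (D : Filter ι), y n i = (x n).1 i := by
    intro n
    induction n with
    | zero => exact Eventually.of_forall fun i => rfl
    | succ n ih =>
      have h1 : ‖π (x (n + 1) - x n)‖ < 1 / 2 / 2 ^ n := by
        rw [map_sub, hx, hx, ← dist_eq_norm]
        exact hu n _ _ n.le_succ le_rfl
      filter_upwards [ih, (hπ _).eventually_lt_const h1] with i hi hi'
      rw [hy, hi, if_pos]
      exact hi'.le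
  choose z hz using fun i => cauchySeq_tendsto_of_complete
    (cauchySeq_of_le_geometric_two (hyd i))
  have hyz : ∀ n i, ‖z i - y n i‖ ≤ 1 / 2 ^ n := fun n i => by
    rw [← dist_eq_norm, dist_comm]
    exact dist_le_of_le_geometric_two_of_tendsto (hyd i) (hz i) n
  have hzmem : z ∈ boundedFamilies D K := by
    obtain ⟨C, hC⟩ := (x 0).2
    refine ⟨max 1 C, ?_⟩
    filter_upwards [hC] with i hi
    rw [← sub_add_cancel (z i) (y 0 i)]
    refine (IsUltrametricDist.norm_add_le_max _ _).trans (max_le_max ?_ hi)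
    simpa using hyz 0 i
  refine ⟨π ⟨z, hzmem⟩, ?_⟩
  rw [tendsto_iff_dist_tendsto_zero]
  refine squeeze_zero (g := fun n => ((1 : ℝ) / 2) ^ n) (fun _ => dist_nonneg) (fun n => ?_)
    (tendsto_pow_atTop_nhds_zero_of_lt_one (by norm_num) (by norm_num))
  rw [← hx, dist_comm, dist_eq_norm, ← map_sub]
  refine le_of_tendsto (hπ _) ?_
  filter_upwards [hyx n] with i hi
  change ‖z i - (x n).1 i‖ ≤ _
  rw [← hi, one_div_pow]
  exact hyz n i

variable [IsUltrametricDist F]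

theorem dist_limPoint (a b : ∀ i, ProjLine (K i)) :
    dist (limPoint hπ a) (limPoint hπ b) =
      dist (MetricUltraproduct.mk D a) (MetricUltraproduct.mk D b) := by
  rw [dist_eq_wedge (isNormalized_limPoint hπ a) (isNormalized_limPoint hπ b),
    MetricUltraproduct.dist_mk, ← map_mul, ← map_mul, ← map_sub]
  exact tendsto_nhds_unique (hπ _) (tendsto_ulim D fun i => dist_mem_Icc (a i) (b i))

theorem pred_limPoint {n : ℕ} (P : MvPolynomial (Fin n) ℤ) (a : Fin n → ∀ i, ProjLine (K i)) :
    LPStructure.pred P (fun k => limPoint hπ (a k)) =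
      LPStructure.pred P fun k => MetricUltraproduct.mk D (a k) := by
  rw [pred_eq_homEval P fun k => isNormalized_limPoint hπ (a k), MetricUltraproduct.pred_mk]
  exact tendsto_nhds_unique (tendsto_norm_homEval hπ P fun k j => boundedRep (a k) j)
    (tendsto_ulim D fun i => LPStructure.pred_mem P fun k => a k i)

/-- A family of points which is `D`-almost everywhere represented by the families `x 0`, `x 1` has
the limit `[π (x 0) : π (x 1)]`. -/
theorem limPoint_eq {a : ∀ i, ProjLine (K i)} {p : ProjLine F} (x : Fin 2 → boundedFamilies D K)
    (h : ∀ᶠ i in (D : Filter ι), IsNormalized (a i) fun j => (x j).1 i)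
    (hp : IsNormalized p fun j => π (x j)) : limPoint hπ a = p := by
  rw [← dist_eq_zero, dist_eq_wedge (isNormalized_limPoint hπ a) hp, ← map_mul, ← map_mul,
    ← map_sub, norm_eq_zero, ← map_zero π]
  refine eq_of_eventuallyEq hπ ?_
  filter_upwards [h] with i hi
  have h0 := dist_eq_wedge (nrep_spec (a i)) hi
  rw [dist_self] at h0
  exact norm_eq_zero.1 h0.symm

theorem limPoint_infty :
    limPoint hπ (fun i => (LPStructure.infty : ProjLine (K i))) = LPStructure.infty := by
  refine limPoint_eq hπ ![1, 0] (Eventually.of_forall fun i => ?_) ?_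
  · convert ProjLine.isNormalized_infty (F := K i) using 1
    ext j
    fin_cases j <;> rfl
  · convert ProjLine.isNormalized_infty (F := F) using 1
    ext j
    fin_cases j
    · exact map_one π
    · exact map_zero π

theorem limPoint_surjective (hs : Function.Surjective π) : Function.Surjective (limPoint hπ) := by
  intro p
  obtain ⟨v, hv⟩ := exists_isNormalized p
  choose w hw using fun j => hs (v j)
  have hlim : Tendsto (fun i => max ‖(w 0).1 i‖ ‖(w 1).1 i‖) D (𝓝 1) := by
    have h := (hπ (w 0)).max (hπ (w 1))
    rwa [hw, hw, hv.1] at h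
  -- The families `w j` are normalized only in the limit; rescaling by `c i`, which is bounded where
  -- the maximum exceeds `1 / 2`, makes them normalized and does not change the point `p`.
  have hex : ∀ i, ∃ (q : ProjLine (K i)) (c : K i), 1 / 2 < max ‖(w 0).1 i‖ ‖(w 1).1 i‖ →
      ‖c‖ ≤ 2 ∧ IsNormalized q fun j => c * (w j).1 i := by
    intro i
    by_cases h : 1 / 2 < max ‖(w 0).1 i‖ ‖(w 1).1 i‖
    · have hne : (fun j => (w j).1 i) ≠ 0 := by
        intro h0
        rw [show (w 0).1 i = 0 from congrFun h0 0, show (w 1).1 i = 0 from congrFun h0 1] at h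
        norm_num at h
      obtain ⟨c, hc, hn⟩ := exists_smul_isNormalized hne
      refine ⟨_, c, fun _ => ⟨?_, hn⟩⟩
      have : ‖c‖ * (1 / 2) ≤ 1 := (mul_le_mul_of_nonneg_left h.le (norm_nonneg _)).trans hc.le
      linarith
    · exact ⟨LPStructure.infty, 0, fun h' => absurd h' h⟩
  choose a c hac using hex
  have hev : ∀ᶠ i in (D : Filter ι), 1 / 2 < max ‖(w 0).1 i‖ ‖(w 1).1 i‖ :=
    hlim.eventually_const_lt (by norm_num)
  let γ : boundedFamilies D K := ⟨c, 2, hev.mono fun i hi => (hac i hi).1⟩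
  have hn : ∀ᶠ i in (D : Filter ι), IsNormalized (a i) fun j => (γ * w j).1 i :=
    hev.mono fun i hi => (hac i hi).2
  have h1 : max ‖π (γ * w 0)‖ ‖π (γ * w 1)‖ = 1 :=
    max_norm_eq_one hπ (hn.mono fun i hi => hi.1)
  refine ⟨a, limPoint_eq hπ (fun j => γ * w j) hn ⟨h1, ?_, ?_⟩⟩
  · intro h0
    rw [show π (γ * w 0) = 0 from congrFun h0 0, show π (γ * w 1) = 0 from congrFun h0 1] at h1
    simp at h1
  · obtain ⟨hv0, rfl⟩ := hv.2
    refine (Projectivization.mk_eq_mk_iff' F _ _ _ hv0).2 ⟨π γ, funext fun j => ?_⟩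
    rw [Pi.smul_apply, smul_eq_mul, map_mul, hw]

/-- The projective line of an ultralimit `F` of the fields `K i` is the metric ultraproduct of
their projective lines. -/
theorem isUnderlyingField_of_surjective (hs : Function.Surjective π) :
    IsUnderlyingField F (MetricUltraproduct D fun i => ProjLine (K i)) := by
  let g : MetricUltraproduct D (fun i => ProjLine (K i)) → ProjLine F :=
    fun m => limPoint hπ (MetricUltraproduct.out D _ m)
  have hg : ∀ a, g (MetricUltraproduct.mk D a) = limPoint hπ a := fun a => by
    rw [← dist_eq_zero, dist_limPoint, MetricUltraproduct.mk_out, dist_self]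
  have hd : ∀ m m', dist (g m) (g m') = dist m m' := fun m m' => by
    rw [dist_limPoint, MetricUltraproduct.mk_out, MetricUltraproduct.mk_out]
  have hbij : Function.Bijective g := by
    refine ⟨fun m m' h => ?_, fun p => ?_⟩
    · rw [← dist_eq_zero, ← hd, h, dist_self]
    · obtain ⟨a, rfl⟩ := limPoint_surjective hπ hs p
      exact ⟨_, hg a⟩
  refine ⟨LPIso.symm
    { Equiv.ofBijective g hbij with
      dist_eq := hd
      map_infty := (hg _).trans (limPoint_infty hπ)
      map_pred := fun P m => ?_ }⟩
  refine (pred_limPoint hπ P _).trans ?_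
  simp only [MetricUltraproduct.mk_out]

end BoundedFamilies

/-! ### The absolute value of `K̄` as a limit -/

section ResidueNorm

variable {ι : Type*} (D : Ultrafilter ι) (K : ι → Type*) [∀ i, NormedField (K i)]

theorem alphaBarZero_zero : alphaBarZero D K 0 = 0 := rfl

theorem alphaBarZero_coe (g : gammaBar D K) :
    alphaBarZero D K (g : WithZero (gammaBar D K)) = (alphaBar D K g : ℝ) := rfl

theorem alphaBarZero_mul (a b : WithZero (gammaBar D K)) :
    alphaBarZero D K (a * b) = alphaBarZero D K a * alphaBarZero D K b := by
  induction a using WithZero.recZeroCoe with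
  | zero => simp [alphaBarZero_zero]
  | coe a =>
    induction b using WithZero.recZeroCoe with
    | zero => simp [alphaBarZero_zero]
    | coe b =>
      rw [← WithZero.coe_mul, alphaBarZero_coe, map_mul]
      rfl

theorem alphaBarZero_strictMono : StrictMono (alphaBarZero D K) := by
  intro a b hab
  induction b using WithZero.recZeroCoe with
  | zero => exact absurd hab not_lt_zero
  | coe b =>
    induction a using WithZero.recZeroCoe with
    | zero => exact (alphaBar D K b).2
    | coe a => exact alphaBar_strictMono D K (WithZero.coe_lt_coe.1 hab)

/-- The standard part of the class of a family of values is its limit along `D`. -/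
theorem tendsto_of_mem_gammaFin {g : ∀ i, valueGroup (K i)} (hg : UProd.mk D g ∈ gammaFin D K) :
    Tendsto (fun i => ((g i : PosReal) : ℝ)) D (𝓝 (stdPart D K ⟨_, hg⟩ : PosReal)) := by
  set r := stdPart D K ⟨_, hg⟩
  have hspec := stdPart_spec D K ⟨_, hg⟩
  have hr : (0 : ℝ) < r := r.2
  have key : ∀ s : PosReal, 1 < s → ∀ᶠ i in (D : Filter ι),
      ((s⁻¹ : PosReal) : ℝ) * r ≤ (g i : PosReal) ∧ ((g i : PosReal) : ℝ) ≤ s * r := by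
    intro s hs
    obtain ⟨h1, h2⟩ := hspec s hs
    rw [le_mul_inv_iff_mul_le, ← map_mul] at h1
    rw [mul_inv_le_iff_le_mul, ← map_mul] at h2
    have h1' : ∀ᶠ i in (D : Filter ι), ((s⁻¹ : PosReal) : ℝ) * r ≤ (g i : PosReal) := h1
    have h2' : ∀ᶠ i in (D : Filter ι), ((g i : PosReal) : ℝ) ≤ s * r := h2
    exact h1'.and h2'
  rw [tendsto_order]
  constructor
  · intro a ha
    obtain ⟨b, hab, hb⟩ := exists_between (max_lt ha hr)
    have hb0 : 0 < b := (le_max_right _ _).trans_lt hab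
    have hs : 1 < (⟨r / b, div_pos hr hb0⟩ : PosReal) := (one_lt_div hb0).2 hb
    filter_upwards [key _ hs] with i hi
    refine ((le_max_left _ _).trans_lt hab).trans_le (le_trans (le_of_eq ?_) hi.1)
    change b = (r / b : ℝ)⁻¹ * r
    field_simp
  · intro a ha
    obtain ⟨b, hb, hab⟩ := exists_between ha
    have hs : 1 < (⟨b / r, div_pos (hr.trans hb) hr⟩ : PosReal) := (one_lt_div hr).2 hb
    filter_upwards [key _ hs] with i hi
    refine lt_of_le_of_lt (hi.2.trans (le_of_eq ?_)) hab
    field_simp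

theorem eventually_valueOf_coe {x : ∀ i, K i} (hx : UProd.mk D x ≠ 0) :
    ∀ᶠ i in (D : Filter ι), ((valueOf (x i) : PosReal) : ℝ) = ‖x i‖ :=
  (UProd.eventually_ne_zero D K hx).mono fun _ h => valueOf_coe h

theorem mem_gammaFin_of_bounds {g : ∀ i, valueGroup (K i)} {r s : ℝ} (hr : 0 < r)
    (hrg : ∀ᶠ i in (D : Filter ι), r ≤ (g i : PosReal))
    (hgs : ∀ᶠ i in (D : Filter ι), ((g i : PosReal) : ℝ) ≤ s) : UProd.mk D g ∈ gammaFin D K := by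
  have hs : 0 < s := by
    obtain ⟨i, hi⟩ := hgs.exists
    exact (g i : PosReal).2.trans_le hi
  exact ⟨⟨r, hr⟩, ⟨s, hs⟩, hrg, hgs⟩

variable [∀ i, IsUltrametricDist (K i)]

theorem ultraValuation_mk {x : ∀ i, K i} (hx : UProd.mk D x ≠ 0) :
    ultraValuation D K (UProd.mk D x) =
      ((UProd.mk D fun i => valueOf (x i) : UValueGroup D K) : WithZero (UValueGroup D K)) :=
  if_neg hx

/-- The valuation ring of the coarsening of `v` by `Γ_fin`. -/
noncomputable abbrev finiteRing : ValuationSubring (UProd D K) :=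
  (coarsening (ultraValuation D K) (gammaFin D K)).valuationSubring

theorem vFinBar_residue (z : finiteRing D K) :
    vFinBar D K (IsLocalRing.residue _ z) = WithZero.map' (QuotientGroup.mk' (gammaInfInFin D K))
      (cutToSubgroup (gammaFin D K) (ultraValuation D K z)) := rfl

theorem mk_mem_finiteRing_iff {x : ∀ i, K i} (hx : UProd.mk D x ≠ 0) :
    UProd.mk D x ∈ finiteRing D K ↔
      ∃ d : ∀ i, valueGroup (K i), UProd.mk D d ∈ gammaFin D K ∧
        ∀ᶠ i in (D : Filter ι), ‖x i‖ ≤ (d i : PosReal) := by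
  rw [Valuation.mem_valuationSubring_iff, coarsening_coe _ _ (ultraValuation_mk D K hx),
    ← WithZero.coe_one, WithZero.coe_le_coe, ← QuotientGroup.mk_one, quotient_mk_le]
  have key : ∀ d : ∀ i, valueGroup (K i), UProd.mk D (fun i => valueOf (x i)) ≤ UProd.mk D d ↔
      ∀ᶠ i in (D : Filter ι), ‖x i‖ ≤ (d i : PosReal) := fun d => by
    rw [UProd.mk_le]
    refine eventually_congr ((eventually_valueOf_coe D K hx).mono fun i hi => ?_)
    rw [← hi]
    rfl
  constructor
  · rintro ⟨d, hd, h⟩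
    obtain ⟨d, rfl⟩ := UProd.mk_surj d
    rw [one_mul] at h
    exact ⟨d, hd, (key d).1 h⟩
  · rintro ⟨d, hd, h⟩
    refine ⟨_, hd, ?_⟩
    rw [one_mul]
    exact (key d).2 h

/-- A bounded family has its class in the valuation ring of `v̄`: if its absolute values exceed
`1`, they are themselves finite. -/
theorem mk_mem_finiteRing {x : ∀ i, K i} (hx : x ∈ boundedFamilies D K) :
    UProd.mk D x ∈ finiteRing D K := by
  by_cases h0 : UProd.mk D x = 0
  · rw [h0]
    exact zero_mem _
  obtain ⟨C, hC⟩ := hx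
  rw [mk_mem_finiteRing_iff D K h0]
  have hval := eventually_valueOf_coe D K h0
  by_cases h1 : ∀ᶠ i in (D : Filter ι), ‖x i‖ ≤ 1
  · exact ⟨fun _ => 1, (gammaFin D K).one_mem, h1⟩
  · rw [← Ultrafilter.eventually_not] at h1
    refine ⟨fun i => valueOf (x i), mem_gammaFin_of_bounds D K (r := 1) (s := C) one_pos ?_ ?_,
      hval.mono fun i hi => hi.ge⟩
    · filter_upwards [hval, h1] with i hi hi'
      rw [hi]
      exact (not_le.1 hi').le
    · filter_upwards [hval, hC] with i hi hi'
      rwa [hi]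

/-- The absolute value `ᾱ ∘ v̄_fin` of `K̄` is the limit of the absolute values of the `K i`. -/
theorem tendsto_alphaBarZero_vFinBar {x : ∀ i, K i} (hx : UProd.mk D x ∈ finiteRing D K) :
    Tendsto (fun i => ‖x i‖) D
      (𝓝 (alphaBarZero D K (vFinBar D K (IsLocalRing.residue _ ⟨_, hx⟩)))) := by
  rw [vFinBar_residue]
  by_cases h0 : UProd.mk D x = 0
  · have hv : ultraValuation D K (UProd.mk D x) = 0 := by rw [h0, map_zero]
    rw [hv, cutToSubgroup_zero, map_zero, alphaBarZero_zero]
    refine tendsto_const_nhds.congr' ?_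
    filter_upwards [UProd.mk_eq.1 h0] with i hi
    rw [hi, norm_zero]
  have hval := eventually_valueOf_coe D K h0
  rw [ultraValuation_mk D K h0]
  by_cases hg : UProd.mk D (fun i => valueOf (x i)) ∈ gammaFin D K
  · rw [cutToSubgroup_mem hg]
    exact (tendsto_of_mem_gammaFin D K hg).congr' hval
  · rw [cutToSubgroup_notMem hg, map_zero, alphaBarZero_zero]
    obtain ⟨d, hd, hxd⟩ := (mk_mem_finiteRing_iff D K h0).1 hx
    obtain ⟨_, s, _, hds⟩ := hd
    have hds : ∀ᶠ i in (D : Filter ι), ((d i : PosReal) : ℝ) ≤ s := hds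
    rw [tendsto_order]
    refine ⟨fun a ha => Eventually.of_forall fun i => ha.trans_le (norm_nonneg _), fun a ha => ?_⟩
    -- If `a ≤ |x i| ≤ s` almost everywhere, then `v x` would be finite.
    by_contra h
    rw [← Ultrafilter.eventually_not] at h
    refine hg (mem_gammaFin_of_bounds D K ha (s := s) ?_ ?_)
    · filter_upwards [hval, h] with i hi hi'
      rw [hi]
      exact not_lt.1 hi'
    · filter_upwards [hval, hxd, hds] with i hi hi' hi''
      rw [hi]
      exact hi'.trans hi''

/-- The class in `K̄` of a bounded family. -/
noncomputable def boundedResidue : boundedFamilies D K →+* KBar D K :=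
  (IsLocalRing.residue (finiteRing D K)).comp
    { toFun := fun x => ⟨UProd.mk D x.1, mk_mem_finiteRing D K x.2⟩
      map_zero' := rfl
      map_one' := rfl
      map_add' := fun _ _ => rfl
      map_mul' := fun _ _ => rfl }

theorem tendsto_boundedResidue (x : boundedFamilies D K) : Tendsto (fun i => ‖x.1 i‖) D
    (𝓝 (alphaBarZero D K (vFinBar D K (boundedResidue D K x)))) :=
  tendsto_alphaBarZero_vFinBar D K (mk_mem_finiteRing D K x.2)

theorem boundedResidue_surjective : Function.Surjective (boundedResidue D K) := by
  intro z
  obtain ⟨⟨z, hz⟩, rfl⟩ := IsLocalRing.residue_surjective z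
  obtain ⟨x, rfl⟩ := UProd.mk_surj z
  exact ⟨⟨x, _, (tendsto_alphaBarZero_vFinBar D K hz).eventually_le_const (lt_add_one _)⟩, rfl⟩

/-- The absolute value `ᾱ ∘ v̄_fin` on `K̄`. -/
noncomputable def residueAbs : AbsoluteValue (KBar D K) ℝ where
  toFun x := alphaBarZero D K (vFinBar D K x)
  map_mul' x y := by rw [map_mul, alphaBarZero_mul]
  nonneg' x := (alphaBarZero_strictMono D K).monotone zero_le
  eq_zero' x := by
    rw [← Valuation.zero_iff (vFinBar D K)]
    exact (alphaBarZero_strictMono D K).injective.eq_iff' (alphaBarZero_zero D K)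
  add_le' x y := by
    refine ((alphaBarZero_strictMono D K).monotone ((vFinBar D K).map_add x y)).trans ?_
    rw [(alphaBarZero_strictMono D K).monotone.map_max]
    exact max_le_add_of_nonneg ((alphaBarZero_strictMono D K).monotone zero_le)
      ((alphaBarZero_strictMono D K).monotone zero_le)

/-- The valuation `v̄_fin` is surjective, as `v` is. -/
theorem exists_vFinBar_eq (g : gammaBar D K) : ∃ x, vFinBar D K x = g := by
  induction g using QuotientGroup.induction_on with
  | H g =>
  obtain ⟨g, hg⟩ := g
  obtain ⟨g, rfl⟩ := UProd.mk_surj g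
  choose u hu using fun i => (g i).2
  have hne : UProd.mk D (fun i => (u i : K i)) ≠ 0 := by
    rw [Ne, UProd.zero_def, UProd.mk_eq]
    intro h
    obtain ⟨i, hi⟩ := h.exists
    exact (u i).ne_zero hi
  have hval : (fun i => valueOf (u i : K i)) = g := funext fun i => by
    refine Subtype.ext (Subtype.ext ?_)
    rw [valueOf_coe (u i).ne_zero, ← hu i]
    rfl
  have hmem : UProd.mk D (fun i => (u i : K i)) ∈ finiteRing D K :=
    (mk_mem_finiteRing_iff D K hne).2 ⟨g, hg, Eventually.of_forall fun i => by rw [← hu i]; rfl⟩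
  refine ⟨IsLocalRing.residue _ ⟨_, hmem⟩, ?_⟩
  rw [vFinBar_residue, ultraValuation_mk D K hne, hval, cutToSubgroup_mem hg]
  rfl

end ResidueNorm

/-! ### Comparison of `K̄` with the underlying metric valued fields -/

theorem mainTheorem5 {ι : Type u} (D : Ultrafilter ι) (K : ι → Type v) [∀ i, NormedField (K i)]
    [∀ i, IsUltrametricDist (K i)] [∀ i, CompleteSpace (K i)] :
    (∃ (F : Type (max u v)) (_ : NormedField F) (_ : IsUltrametricDist F) (_ : CompleteSpace F),
      IsUnderlyingField F (MetricUltraproduct D fun i => ProjLine (K i))) ∧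
    ∀ (Kme : Type w) [NormedField Kme] [IsUltrametricDist Kme] [CompleteSpace Kme],
      IsUnderlyingField Kme (MetricUltraproduct D fun i => ProjLine (K i)) →
      ∃ f : KBar D K ≃+* Kme,
        (∀ x y : KBar D K, vFinBar D K x ≤ vFinBar D K y ↔ ‖f x‖ ≤ ‖f y‖) ∧
        (∀ x : KBar D K, ‖f x‖ = alphaBarZero D K (vFinBar D K x)) ∧
        valueGroup Kme = (alphaBar D K).range := by
  let _ : NormedField (KBar D K) := (residueAbs D K).toNormedField
  have hπ : ∀ x : boundedFamilies D K,
      Tendsto (fun i => ‖x.1 i‖) D (𝓝 ‖boundedResidue D K x‖) := tendsto_boundedResidue D K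
  have hs := boundedResidue_surjective D K
  have : IsUltrametricDist (KBar D K) := isUltrametricDist_of_surjective hπ hs
  have hU := isUnderlyingField_of_surjective hπ hs
  refine ⟨⟨KBar D K, inferInstance, inferInstance, completeSpace_of_surjective hπ hs, hU⟩, ?_⟩
  intro Kme _ _ _ hKme
  obtain ⟨e⟩ := hU
  obtain ⟨e'⟩ := hKme
  obtain ⟨f, hf⟩ := (e.trans e'.symm).exists_ringEquiv
  have hf' : ∀ x : KBar D K, ‖f x‖ = alphaBarZero D K (vFinBar D K x) := hf
  refine ⟨f, fun x y => ?_, hf', ?_⟩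
  · rw [hf', hf', (alphaBarZero_strictMono D K).le_iff_le]
  · ext r
    constructor
    · rintro ⟨y, rfl⟩
      have hx : f.symm y ≠ 0 := by simp
      have hne : vFinBar D K (f.symm y) ≠ 0 := (Valuation.ne_zero_iff _).2 hx
      obtain ⟨g, hg⟩ := WithZero.ne_zero_iff_exists.1 hne
      refine ⟨g, Subtype.ext ?_⟩
      have h := hf' (f.symm y)
      rw [← hg, RingEquiv.apply_symm_apply] at h
      exact h.symm
    · rintro ⟨g, rfl⟩
      obtain ⟨x, hx⟩ := exists_vFinBar_eq D K g
      have hx0 : x ≠ 0 := by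
        rintro rfl
        rw [map_zero] at hx
        exact WithZero.coe_ne_zero hx.symm
      refine ⟨Units.mk0 (f x) (by simpa using hx0), Subtype.ext ?_⟩
      have h := hf' x
      rw [hx] at h
      exact h
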